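/- Let $n\ge 1$, let $(X,\omega)$ be a symplectic manifold of dimension $2n$ (for instance a Calabi--Yau manifold), and let $L$ be a smooth compact $n$-manifold with (possibly empty) boundary, whose boundary components are listed as $C_1,\dots,C_d$. Let $\Lambda_1,\dots,\Lambda_d\subset X$ be pairwise disjoint embedded Lagrangian submanifolds. Let $\operatorname{Diff}(L)$ be the group of diffeomorphisms $\psi$ of $L$ with $\psi(C_i)\subset C_i$ for all $i$. An immersion $f:L\to X$ is *free* if $\psi\in\operatorname{Diff}(L)$ and $f\circ\psi=f$ imply $\psi=\operatorname{id}_L$, it is *Lagrangian* if $f^*\omega=0$, and it has *boundary conditions* $\Lambda_1,\dots,\Lambda_d$ if $f(C_i)\subset\Lambda_i$ and $df(T_pL)\not\subset T_{f(p)}\Lambda_i$ for all $p\in C_i$ and all $i$. Let $\mathcal L=\mathcal L(X,L;\Lambda_1,\dots,\Lambda_d)$ be the set of free Lagrangian immersions $L\to X$ with these boundary conditions modulo $f\sim f\circ\psi$, $\psi\in\operatorname{Diff}(L)$. For $Y=[0,1]$ or $Y=[0,1]^2$, a *smooth lifting* of a map $\mathcal Z:Y\to\mathcal L$ is a smooth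 map $f:Y\times L\to X$ such that each $f_y:=f(y,\cdot)$ is a free Lagrangian immersion representing $\mathcal Z(y)$; the map $\mathcal Z$ is *smooth* if it has a smooth lifting. Two smooth paths $\mathcal Z,\bar{\mathcal Z}:[0,1]\to\mathcal L$ with the same end points are *homotopic with fixed end points* if there is a smooth map $\mathcal H:[0,1]^2\to\mathcal L$ with $\mathcal H(0,t)=\mathcal Z_t$, $\mathcal H(1,t)=\bar{\mathcal Z}_t$, $\mathcal H(u,0)=\mathcal Z_0=\bar{\mathcal Z}_0$ and $\mathcal H(u,1)=\mathcal Z_1=\bar{\mathcal Z}_1$ for all $t,u\in[0,1]$. Let $H^1(L,\partial L;\mathbb R)$ be the space of smooth closed $1$-forms on $L$ whose pullback to $\partial L$ vanishes, modulo the differentials of smooth functions vanishing on $\partial L$. (1) For every path $\mathcal Z:[0,1]\to\mathcal L$ and every smooth lifting $f:[0,1]\times L\to X$ of $\mathcal Z$, the integral $\int_0^1 f_t^*\, i_{\frac{df_t}{dt}}\omega\,dt$ exists and is a smooth closed $1$-form on $L$ whose pullback to $\partial L$ vanishes. Hence the relative Lagrangian flux $$RF(f):=\Big[\int_0^1 f_t^*\,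 i_{\frac{df_t}{dt}}\omega\,dt\Big]\in H^1(L,\partial L;\mathbb R)$$ is well defined. (2) $RF(f)$ depends only on $f_0$ and on the fixed-end-point homotopy class of $\mathcal Z$: if $\mathcal Z,\bar{\mathcal Z}:[0,1]\to\mathcal L$ are homotopic with fixed end points and $f,\bar f$ are smooth liftings of $\mathcal Z,\bar{\mathcal Z}$ with $f_0=\bar f_0$, then $RF(f)=RF(\bar f)$. -/

import Mathlib

open scoped Manifold ContDiff

noncomputable section

namespace LagFlux

/-! ### Differential forms on manifolds (possibly with boundary) -/

section Forms

variable {E : Type*} [NormedAddCommGroup E] [NormedSpace ℝ E]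
  {H : Type*} [TopologicalSpace H]

/-- A (not necessarily smooth) real differential `k`-form on `M`. -/
abbrev DForm (I : ModelWithCorners ℝ E H) (M : Type*) [TopologicalSpace M] [ChartedSpace H M]
    (k : ℕ) : Type _ :=
  (x : M) → TangentSpace I x [⋀^Fin k]→L[ℝ] ℝ

variable {I : ModelWithCorners ℝ E H} {M : Type*} [TopologicalSpace M] [ChartedSpace H M] {k : ℕ}

instance : AddCommGroup (DForm I M k) := Pi.addCommGroup

instance : Module ℝ (DForm I M k) := Pi.module _ _ _

/-- The coordinate expression of a `k`-form in the chart around `x₀`: its pullback by the inverse of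
the chart, a form on (an open part of the range of the model in) the model vector space. -/
def chartRep (η : DForm I M k) (x₀ : M) (y : E) : E [⋀^Fin k]→L[ℝ] ℝ :=
  (η ((extChartAt I x₀).symm y)).compContinuousLinearMap
    (mfderivWithin 𝓘(ℝ, E) I (extChartAt I x₀).symm (Set.range I) y)

/-- A form is smooth if all its coordinate expressions are smooth (up to the boundary). -/
def IsSmoothForm (η : DForm I M k) : Prop :=
  ∀ x₀ : M, ContDiffOn ℝ ∞ (chartRep η x₀) (extChartAt I x₀).target

/-- The exterior derivative: at `x`, the exterior derivative of the coordinate expression in the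
chart around `x`, pulled back by that chart. -/
def extD (η : DForm I M k) : DForm I M (k + 1) := fun x =>
  (extDerivWithin (chartRep η x) (Set.range I) (extChartAt I x x)).compContinuousLinearMap
    (mfderiv I 𝓘(ℝ, E) (extChartAt I x) x)

/-- The interior product `i_v η` of an alternating form on the tangent space at `x`. -/
def interiorProd {x : M} (v : TangentSpace I x) (η : TangentSpace I x [⋀^Fin (k + 1)]→L[ℝ] ℝ) :
    TangentSpace I x [⋀^Fin k]→L[ℝ] ℝ :=
  ContinuousAlternatingMap.curryLeft (E := E) η v

theorem chartRep_add (η ζ : DForm I M k) (x₀ : M) :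
    chartRep (η + ζ) x₀ = chartRep η x₀ + chartRep ζ x₀ := rfl

theorem chartRep_smul (c : ℝ) (η : DForm I M k) (x₀ : M) :
    chartRep (c • η) x₀ = c • chartRep η x₀ := rfl

theorem chartRep_zero (x₀ : M) : chartRep (0 : DForm I M k) x₀ = 0 := rfl

theorem IsSmoothForm.add {η ζ : DForm I M k} (hη : IsSmoothForm η) (hζ : IsSmoothForm ζ) :
    IsSmoothForm (η + ζ) := fun x₀ => by
  rw [chartRep_add]; exact (hη x₀).add (hζ x₀)

theorem IsSmoothForm.smul (c : ℝ) {η : DForm I M k} (hη : IsSmoothForm η) :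
    IsSmoothForm (c • η) := fun x₀ => by
  rw [chartRep_smul]; exact contDiffOn_const.smul (hη x₀)

theorem isSmoothForm_zero : IsSmoothForm (0 : DForm I M k) := fun x₀ => by
  rw [chartRep_zero]; exact contDiffOn_const

theorem IsSmoothForm.differentiableWithinAt {η : DForm I M k} (hη : IsSmoothForm η) (x : M) :
    DifferentiableWithinAt ℝ (chartRep η x) (Set.range I) (extChartAt I x x) :=
  (((hη x) _ (mem_extChartAt_target x)).differentiableWithinAt (by simp)).mono_of_mem_nhdsWithin
    (extChartAt_target_mem_nhdsWithin x)

theorem extD_add {η ζ : DForm I M k} (hη : IsSmoothForm η) (hζ : IsSmoothForm ζ) :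
    extD (η + ζ) = extD η + extD ζ := by
  funext x
  have h : extDerivWithin (chartRep (η + ζ) x) (Set.range I) (extChartAt I x x) = _ :=
    extDerivWithin_add (I.uniqueDiffOn _ (by simp [extChartAt]))
      (hη.differentiableWithinAt x) (hζ.differentiableWithinAt x)
  simp only [extD, h]
  rfl

theorem extD_smul (c : ℝ) (η : DForm I M k) : extD (c • η) = c • extD η := by
  funext x
  have h : extDerivWithin (chartRep (c • η) x) (Set.range I) (extChartAt I x x) = _ :=
    extDerivWithin_smul c (chartRep η x) (I.uniqueDiffOn _ (by simp [extChartAt]))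
  simp only [extD, h]
  rfl

theorem extD_zero : extD (0 : DForm I M k) = 0 := by
  simpa using extD_smul (0 : ℝ) (0 : DForm I M k)

end Forms

/-! ### Relative de Rham cohomology of a manifold with boundary -/

section Relative

variable {n : ℕ} [NeZero n] {L : Type*} [TopologicalSpace L] [ChartedSpace (EuclideanHalfSpace n) L]

/-- The vectors of `T_p L` which are tangent to `∂L`, for `p ∈ ∂L`: the half space is
`{x | 0 ≤ x 0}`, so these are the vectors whose zeroth coordinate vanishes. -/
def boundaryTangent (p : L) : Set (TangentSpace (𝓡∂ n) p) :=
  {v | NormedSpace.fromTangentSpace (𝕜 := ℝ) (extChartAt (𝓡∂ n) p p)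
    (mfderiv (𝓡∂ n) 𝓘(ℝ, EuclideanSpace ℝ (Fin n)) (extChartAt (𝓡∂ n) p) p v) 0 = 0}

/-- The pullback of the form to `∂L` is zero. -/
def VanishesOnBoundary {k : ℕ} (η : DForm (𝓡∂ n) L k) : Prop :=
  ∀ p ∈ (𝓡∂ n).boundary L, ∀ v : Fin k → TangentSpace (𝓡∂ n) p,
    (∀ i, v i ∈ boundaryTangent p) → η p v = 0

variable (n L) in
/-- `Ω^k(L, ∂L)`: smooth `k`-forms on `L` whose pullback to `∂L` is zero. -/
def relForms (k : ℕ) : Submodule ℝ (DForm (𝓡∂ n) L k) where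
  carrier := {η | IsSmoothForm η ∧ VanishesOnBoundary η}
  add_mem' := fun ha hb => ⟨ha.1.add hb.1, fun p hp v hv => by
    simp [ha.2 p hp v hv, hb.2 p hp v hv]⟩
  zero_mem' := ⟨isSmoothForm_zero, fun _ _ _ _ => rfl⟩
  smul_mem' := fun c _ ha => ⟨ha.1.smul c, fun p hp v hv => by simp [ha.2 p hp v hv]⟩

variable (n L) in
/-- Closed forms in `Ω^k(L, ∂L)`. -/
def relClosed (k : ℕ) : Submodule ℝ (DForm (𝓡∂ n) L k) where
  carrier := {η | η ∈ relForms n L k ∧ extD η = 0}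
  add_mem' := fun ha hb => ⟨add_mem ha.1 hb.1, by
    rw [extD_add ha.1.1 hb.1.1, ha.2, hb.2, add_zero]⟩
  zero_mem' := ⟨zero_mem _, extD_zero⟩
  smul_mem' := fun c _ ha => ⟨Submodule.smul_mem _ c ha.1, by rw [extD_smul, ha.2, smul_zero]⟩

variable (n L) in
/-- The image of `d : Ω^k(L, ∂L) → Ω^{k+1}(L, ∂L)`. -/
def relExact (k : ℕ) : Submodule ℝ (DForm (𝓡∂ n) L (k + 1)) where
  carrier := {θ | ∃ η ∈ relForms n L k, extD η = θ}
  add_mem' := by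
    rintro _ _ ⟨a, ha, rfl⟩ ⟨b, hb, rfl⟩
    exact ⟨a + b, add_mem ha hb, extD_add ha.1 hb.1⟩
  zero_mem' := ⟨0, zero_mem _, extD_zero⟩
  smul_mem' := by
    rintro c _ ⟨a, ha, rfl⟩
    exact ⟨c • a, Submodule.smul_mem _ c ha, extD_smul c a⟩

variable (n L) in
/-- The relative de Rham cohomology `H^1(L, ∂L; ℝ)`: closed 1-forms vanishing on `∂L`, modulo the
differentials of smooth functions vanishing on `∂L`. -/
abbrev RelH1 : Type _ := relClosed n L 1 ⧸ (relExact n L 0).submoduleOf (relClosed n L 1)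

end Relative

/-! ### Boundary components and reparametrizations of `L` -/

section Reparam

variable {n : ℕ} [NeZero n] {L : Type*} [TopologicalSpace L] [ChartedSpace (EuclideanHalfSpace n) L]

variable (n) in
/-- `C 0, …, C (d - 1)` lists the connected components of `∂L`, without repetition. -/
def IsBoundaryEnumeration {d : ℕ} (C : Fin d → Set L) : Prop :=
  Function.Injective C ∧
    Set.range C = {S | ∃ x ∈ (𝓡∂ n).boundary L, S = connectedComponentIn ((𝓡∂ n).boundary L) x}

/-- `ψ ∈ Diff(L)`: the diffeomorphism `ψ` maps every connected component of `∂L` into itself. -/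
def PreservesBoundaryComponents (ψ : L ≃ₘ^∞⟮𝓡∂ n, 𝓡∂ n⟯ L) : Prop :=
  ∀ x ∈ (𝓡∂ n).boundary L, Set.MapsTo ψ (connectedComponentIn ((𝓡∂ n).boundary L) x)
    (connectedComponentIn ((𝓡∂ n).boundary L) x)

theorem PreservesBoundaryComponents.symm [IsManifold (𝓡∂ n) ∞ L] {ψ : L ≃ₘ^∞⟮𝓡∂ n, 𝓡∂ n⟯ L}
    (h : PreservesBoundaryComponents ψ) : PreservesBoundaryComponents ψ.symm := by
  intro x hx y hy
  have hyb : y ∈ (𝓡∂ n).boundary L := connectedComponentIn_subset _ _ hy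
  have hz : ψ.symm y ∈ (𝓡∂ n).boundary L :=
    ((ψ.symm.isLocalDiffeomorph y).isBoundaryPoint_iff (by simp)).1 hyb
  have h1 := h _ hz (mem_connectedComponentIn hz)
  rw [Diffeomorph.apply_symm_apply] at h1
  rw [connectedComponentIn_eq hy, ← connectedComponentIn_eq h1]
  exact mem_connectedComponentIn hz

end Reparam

/-! ### Symplectic manifolds and Lagrangian submanifolds -/

section Symplectic

variable {n : ℕ} {X : Type*} [TopologicalSpace X]
  [ChartedSpace (EuclideanSpace ℝ (Fin (2 * n))) X]

/-- `ωX` is a symplectic form: a smooth, closed, nondegenerate 2-form. -/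
structure IsSymplectic (ωX : DForm (𝓡 (2 * n)) X 2) : Prop where
  smooth : IsSmoothForm ωX
  closed : extD ωX = 0
  nondegenerate : ∀ (x : X) (v : TangentSpace (𝓡 (2 * n)) x),
    (∀ w : TangentSpace (𝓡 (2 * n)) x, ωX x ![v, w] = 0) → v = 0

/-- `φ` is a smooth chart of `X` in which the subset `Λ` is the `n`-dimensional linear slice `V`. -/
structure IsSliceChart (Λ : Set X)
    (φ : OpenPartialHomeomorph X (EuclideanSpace ℝ (Fin (2 * n))))
    (V : Submodule ℝ (EuclideanSpace ℝ (Fin (2 * n)))) : Prop where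
  mem_atlas : φ ∈ IsManifold.maximalAtlas (𝓡 (2 * n)) ∞ X
  finrank_eq : Module.finrank ℝ V = n
  mem_iff : ∀ x ∈ φ.source, x ∈ Λ ↔ φ x ∈ V

/-- The tangent space `T_q Λ ⊆ T_q X` of an embedded `n`-dimensional submanifold `Λ` at `q ∈ Λ`,
read off in a slice chart around `q` (all slice charts give the same answer). -/
def tangentOf (Λ : Set X) (q : X) : Set (TangentSpace (𝓡 (2 * n)) q) :=
  {v | ∃ φ V, IsSliceChart (n := n) Λ φ V ∧ q ∈ φ.source ∧
    NormedSpace.fromTangentSpace (𝕜 := ℝ) (φ q)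
      (mfderiv (𝓡 (2 * n)) 𝓘(ℝ, EuclideanSpace ℝ (Fin (2 * n))) φ q v) ∈ V}

/-- `Λ ⊆ X` is an embedded Lagrangian submanifold: an embedded submanifold of half the dimension on
whose tangent spaces `ωX` vanishes. -/
structure IsLagrangianSubmanifold (ωX : DForm (𝓡 (2 * n)) X 2) (Λ : Set X) : Prop where
  embedded : ∀ q ∈ Λ, ∃ φ V, IsSliceChart (n := n) Λ φ V ∧ q ∈ φ.source
  isotropic : ∀ q ∈ Λ, ∀ v ∈ tangentOf (n := n) Λ q, ∀ w ∈ tangentOf (n := n) Λ q,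
    ωX q ![v, w] = 0

end Symplectic

/-! ### The moduli space of free immersed Lagrangians with boundary conditions -/

section Moduli

variable {n : ℕ} [NeZero n]
  {X : Type*} [TopologicalSpace X] [ChartedSpace (EuclideanSpace ℝ (Fin (2 * n))) X]
  {L : Type*} [TopologicalSpace L] [ChartedSpace (EuclideanHalfSpace n) L]

/-- Free Lagrangian immersions `L → X` with boundary conditions `Λ`, where `C i` is the boundary
component of `L` which is to be mapped to `Λ i`. -/
structure LagImmersion {d : ℕ} (ωX : DForm (𝓡 (2 * n)) X 2) (C : Fin d → Set L)
    (Λ : Fin d → Set X) where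
  /-- The underlying map. -/
  toFun : L → X
  smooth : ContMDiff (𝓡∂ n) (𝓡 (2 * n)) ∞ toFun
  immersion : ∀ p, Function.Injective (mfderiv (𝓡∂ n) (𝓡 (2 * n)) toFun p)
  free : ∀ ψ : L ≃ₘ^∞⟮𝓡∂ n, 𝓡∂ n⟯ L, PreservesBoundaryComponents ψ →
    toFun ∘ ψ = toFun → ∀ p, ψ p = p
  lagrangian : ∀ p,
    (ωX (toFun p)).compContinuousLinearMap (mfderiv (𝓡∂ n) (𝓡 (2 * n)) toFun p) = 0
  boundary_mem : ∀ i, ∀ p ∈ C i, toFun p ∈ Λ i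
  boundary_transverse : ∀ i, ∀ p ∈ C i,
    ¬ Set.range (mfderiv (𝓡∂ n) (𝓡 (2 * n)) toFun p) ⊆ tangentOf (n := n) (Λ i) (toFun p)

variable [IsManifold (𝓡∂ n) ∞ L]

/-- Two immersions are equivalent if they differ by a reparametrization in `Diff(L)`. -/
instance reparamSetoid {d : ℕ} (ωX : DForm (𝓡 (2 * n)) X 2) (C : Fin d → Set L)
    (Λ : Fin d → Set X) : Setoid (LagImmersion ωX C Λ) where
  r f f' := ∃ ψ : L ≃ₘ^∞⟮𝓡∂ n, 𝓡∂ n⟯ L, PreservesBoundaryComponents ψ ∧ f'.toFun = f.toFun ∘ ψ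
  iseqv :=
    { refl := fun _ => ⟨Diffeomorph.refl _ _ _, fun _ _ => Set.mapsTo_id _, rfl⟩
      symm := by
        rintro f f' ⟨ψ, hψ, h⟩
        refine ⟨ψ.symm, hψ.symm, ?_⟩
        rw [h]
        funext p
        simp
      trans := by
        rintro f f' f'' ⟨ψ, hψ, h⟩ ⟨χ, hχ, h'⟩
        refine ⟨χ.trans ψ, fun x hx => (hψ x hx).comp (hχ x hx), ?_⟩
        rw [h', h]
        rfl }

/-- The moduli space `ℒ(X, L; Λ)` of free immersed Lagrangian submanifolds of type `L` with boundary
conditions `Λ`. -/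
def Moduli {d : ℕ} (ωX : DForm (𝓡 (2 * n)) X 2) (C : Fin d → Set L) (Λ : Fin d → Set X) : Type _ :=
  Quotient (reparamSetoid ωX C Λ)

section Families

variable {F : Type*} [NormedAddCommGroup F] [NormedSpace ℝ F] {G : Type*} [TopologicalSpace G]
  {Y : Type*} [TopologicalSpace Y] [ChartedSpace G Y]
  {d : ℕ} {ωX : DForm (𝓡 (2 * n)) X 2} {C : Fin d → Set L} {Λ : Fin d → Set X}

/-- `f : Y × L → X` is a smooth lifting of `Z : Y → ℒ(X, L; Λ)`: it is smooth and each
`f (y, ·)` is a free Lagrangian immersion representing `Z y`. -/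
def IsSmoothLift (J : ModelWithCorners ℝ F G) (Z : Y → Moduli ωX C Λ) (f : Y × L → X) : Prop :=
  ContMDiff (J.prod (𝓡∂ n)) (𝓡 (2 * n)) ∞ f ∧
    ∀ y, ∃ g : LagImmersion ωX C Λ, g.toFun = (fun p => f (y, p)) ∧
      Z y = Quotient.mk (reparamSetoid ωX C Λ) g

/-- A family `Z : Y → ℒ(X, L; Λ)` is smooth if it admits a smooth lifting. -/
def IsSmoothFamily (J : ModelWithCorners ℝ F G) (Z : Y → Moduli ωX C Λ) : Prop :=
  ∃ f : Y × L → X, IsSmoothLift J Z f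

/-- `Z` and `Z'` are smoothly homotopic relative to their end points. -/
def SmoothlyHomotopic (Z Z' : unitInterval → Moduli ωX C Λ) : Prop :=
  ∃ H : unitInterval × unitInterval → Moduli ωX C Λ,
    IsSmoothFamily ((𝓡∂ 1).prod (𝓡∂ 1)) H ∧
    (∀ t, H (0, t) = Z t) ∧ (∀ t, H (1, t) = Z' t) ∧
    (∀ u, H (u, 0) = Z 0 ∧ H (u, 0) = Z' 0) ∧ (∀ u, H (u, 1) = Z 1 ∧ H (u, 1) = Z' 1)

end Families

end Moduli

/-! ### The relative Lagrangian flux -/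

section Flux

variable {n : ℕ} [NeZero n]
  {X : Type*} [TopologicalSpace X] [ChartedSpace (EuclideanSpace ℝ (Fin (2 * n))) X]
  {L : Type*} [TopologicalSpace L] [ChartedSpace (EuclideanHalfSpace n) L]

/-- The velocity `(d f_t / dt)(p)`; here `1` is the unit tangent vector of `[0, 1]` at `t`. -/
def velocity (f : unitInterval × L → X) (t : unitInterval) (p : L) :
    TangentSpace (𝓡 (2 * n)) (f (t, p)) :=
  mfderiv (𝓡∂ 1) (𝓡 (2 * n)) (fun s : unitInterval => f (s, p)) t (1 : TangentSpace (𝓡∂ 1) t)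

/-- The value at `p` of the 1-form `f_t^* i_{d f_t / dt} ωX`. It is typed as an alternating form on
the model space, of which `T_p L` is a type synonym, so that the integral in `t` makes sense. -/
def fluxIntegrand (ωX : DForm (𝓡 (2 * n)) X 2) (f : unitInterval × L → X) (p : L)
    (t : unitInterval) : EuclideanSpace ℝ (Fin n) [⋀^Fin 1]→L[ℝ] ℝ :=
  (interiorProd (velocity f t p) (ωX (f (t, p)))).compContinuousLinearMap
    (mfderiv (𝓡∂ n) (𝓡 (2 * n)) (fun q : L => f (t, q)) p)

/-- The 1-form `∫₀¹ f_t^* i_{d f_t / dt} ωX dt` on `L`. -/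
def fluxForm (ωX : DForm (𝓡 (2 * n)) X 2) (f : unitInterval × L → X) : DForm (𝓡∂ n) L 1 :=
  fun p => (∫ t : unitInterval, fluxIntegrand ωX f p t :
    EuclideanSpace ℝ (Fin n) [⋀^Fin 1]→L[ℝ] ℝ)

/-- The relative Lagrangian flux: the class of the flux form, once this is known to be a closed form
vanishing on `∂L`. -/
def relFlux (ωX : DForm (𝓡 (2 * n)) X 2) (f : unitInterval × L → X)
    (h : fluxForm ωX f ∈ relClosed n L 1) : RelH1 n L :=
  Submodule.Quotient.mk ⟨fluxForm ωX f, h⟩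

end Flux

end LagFlux

end

/-! Both parts are Cartan calculus for the pullback `Θ` of `ωX` to a product of parameters with a
chart of `L`; `Θ` is closed because `ωX` is.

For a single path, the flux form in a chart is `∫ Θ(∂_t, ·) dt`. The Lagrangian condition says that
`Θ` vanishes on pairs of vectors tangent to a slice `{t} × L`, so `dΘ(∂_t, v, w) = 0` reduces to
`∂_v Θ(∂_t, w) = ∂_w Θ(∂_t, v)`. Differentiating under the integral sign gives closedness
(`extD_fluxForm`). At a boundary point, both the velocity and the derivative of `f_t` along a
boundary direction are tangent to the same `Λ i`, which is isotropic, so the form vanishes on `∂L`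
(`vanishesOnBoundary_fluxForm`).

For a two-parameter family `h (u, t, p)`, let `A(p)` be the `ωX`-area of the square `h (·, ·, p)`.
Integrating `dΘ(∂_u, ∂_t, v) = 0` over the square expresses `dA` as the flux form at `u = 0` minus
the one at `u = 1`, plus terms `Θ(∂_u, v)` on the edges `t = 0, 1`. The edge terms vanish if there
`h` only moves by reparametrizations of one fixed Lagrangian immersion, and `A` vanishes on `∂L`
because the square of a boundary point stays in one `Λ i`. This is `fluxForm_sub_mem_relExact`; it
asks nothing Lagrangian of the intermediate immersions.

It is applied three times: to the lifted homotopy, reparametrized so that every path in it starts at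
`f_0`, and, on each of the sides `u = 0, 1`, to compare two liftings of the same path with the same
start.

These comparisons need the diffeomorphisms relating two smooth liftings, given only separately at
each time, to depend smoothly on time (`contMDiff_reparametrization`). Compactness of `L` and local
injectivity of immersions make them converge, along ultrafilters, to a diffeomorphism solving the
same equation, and freeness leaves only one such diffeomorphism; this gives continuity. A continuous
solution of `f (t, a (t, p)) = g (t, p)` with `f` a family of immersions is then smooth
(`contMDiff_of_comp_immersion`). -/

noncomputable section

namespace LagFlux

open Set Filter Topology MeasureTheory

/-! ### Differentiation under the integral sign on domains with boundary. -/

section ParametricIntegral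

theorem intervalIntegrable_slice {E G : Type*} [TopologicalSpace E] [NormedAddCommGroup G]
    {U : Set E} {F : ℝ × E → G}
    (hF : ContinuousOn F (Icc 0 1 ×ˢ U)) {y : E} (hy : y ∈ U) :
    IntervalIntegrable (fun t => F (t, y)) volume 0 1 := by
  apply ContinuousOn.intervalIntegrable
  rw [uIcc_of_le zero_le_one]
  exact hF.comp (by fun_prop) fun t ht => ⟨ht, hy⟩

universe u

variable {E G : Type u} [NormedAddCommGroup E] [NormedSpace ℝ E] [NormedAddCommGroup G]
  [NormedSpace ℝ G]

/-- Every point of `U` has arbitrarily small convex relative neighbourhoods. -/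
def LocallyConvexSet (U : Set E) : Prop :=
  ∀ y ∈ U, ∃ r > 0, Convex ℝ (U ∩ Metric.ball y r)

/-- The derivative in the second variable of a function on `[0, 1] × U`. -/
def partialFDeriv (F : ℝ × E → G) (U : Set E) (z : ℝ × E) : E →L[ℝ] G :=
  (fderivWithin ℝ F (Icc 0 1 ×ˢ U) z).comp (ContinuousLinearMap.inr ℝ ℝ E)

variable {U : Set E} {F : ℝ × E → G}

theorem uniqueDiffOn_Icc_prod (hU : UniqueDiffOn ℝ U) :
    UniqueDiffOn ℝ (Icc (0 : ℝ) 1 ×ˢ U) :=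
  (uniqueDiffOn_Icc zero_lt_one).prod hU

theorem hasFDerivWithinAt_partialFDeriv (hF : DifferentiableOn ℝ F (Icc 0 1 ×ˢ U))
    {t : ℝ} (ht : t ∈ Icc (0 : ℝ) 1) {y : E} (hy : y ∈ U) :
    HasFDerivWithinAt (fun y => F (t, y)) (partialFDeriv F U (t, y)) U y := by
  have h1 := (hF (t, y) ⟨ht, hy⟩).hasFDerivWithinAt
  have h2 : HasFDerivWithinAt (fun y : E => (t, y)) (ContinuousLinearMap.inr ℝ ℝ E) U y :=
    (hasFDerivAt_prodMk_right t y).hasFDerivWithinAt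
  exact h1.comp y h2 fun y' hy' => ⟨ht, hy'⟩

theorem contDiffOn_partialFDeriv (hU : UniqueDiffOn ℝ U)
    (hF : ContDiffOn ℝ ∞ F (Icc 0 1 ×ˢ U)) :
    ContDiffOn ℝ ∞ (partialFDeriv F U) (Icc 0 1 ×ˢ U) :=
  (hF.fderivWithin (uniqueDiffOn_Icc_prod hU) (m := ∞) (by simp)).clm_comp contDiffOn_const

/-- Compactness of `[0, 1]` makes the continuity of the partial derivative at `y₀` uniform in `t`.
The mean value inequality on a small convex piece of `U` then bounds the Taylor remainder of every
slice by the same `ε * ‖y - y₀‖`, and this bound integrates. Local convexity replaces openness, so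
boundary points of `U` are allowed. -/
theorem hasFDerivWithinAt_integral_slice [CompleteSpace G] (hU : UniqueDiffOn ℝ U)
    (hUc : LocallyConvexSet U)
    (hF : ContDiffOn ℝ ∞ F (Icc 0 1 ×ˢ U)) {y₀ : E} (hy₀ : y₀ ∈ U) :
    HasFDerivWithinAt (fun y => ∫ t in (0 : ℝ)..1, F (t, y))
      (∫ t in (0 : ℝ)..1, partialFDeriv F U (t, y₀)) U y₀ := by
  have hF' := contDiffOn_partialFDeriv hU hF
  have hint := fun {y} (hy : y ∈ U) => intervalIntegrable_slice hF.continuousOn hy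
  have hint' := intervalIntegrable_slice hF'.continuousOn hy₀
  rw [hasFDerivWithinAt_iff_isLittleO, Asymptotics.isLittleO_iff]
  intro ε hε
  obtain ⟨r, hr, hconv⟩ := hUc y₀ hy₀
  obtain ⟨v, hv, hvε⟩ := (isCompact_Icc (a := (0 : ℝ)) (b := 1)).mem_uniformity_of_prod
    (f := fun y t => partialFDeriv F U (t, y)) (s := U) (q := y₀)
    (hF'.continuousOn.comp (f := fun z : E × ℝ => (z.2, z.1)) (by fun_prop)
      fun z hz => ⟨hz.2, hz.1⟩)
    hy₀ (Metric.dist_mem_uniformity hε)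
  obtain ⟨δ, hδ, hδv⟩ := Metric.mem_nhdsWithin_iff.1 hv
  have hρ : 0 < min r δ := lt_min hr hδ
  have hconv' : Convex ℝ (U ∩ Metric.ball y₀ (min r δ)) := by
    have : U ∩ Metric.ball y₀ (min r δ) =
        (U ∩ Metric.ball y₀ r) ∩ Metric.ball y₀ (min r δ) := by
      rw [inter_assoc, inter_eq_self_of_subset_right
        (Metric.ball_subset_ball (min_le_left r δ))]
    rw [this]
    exact hconv.inter (convex_ball _ _)
  filter_upwards [inter_mem self_mem_nhdsWithin
    (mem_nhdsWithin_of_mem_nhds (Metric.ball_mem_nhds y₀ hρ))] with y hy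
  have hle : ∀ t ∈ Icc (0 : ℝ) 1,
      ‖F (t, y) - F (t, y₀) - partialFDeriv F U (t, y₀) (y - y₀)‖ ≤ ε * ‖y - y₀‖ := by
    intro t ht
    refine hconv'.norm_image_sub_le_of_norm_hasFDerivWithin_le'
      (f := fun y => F (t, y)) (f' := fun y => partialFDeriv F U (t, y))
      (fun x hx => (hasFDerivWithinAt_partialFDeriv (hF.differentiableOn (by simp)) ht
        hx.1).mono inter_subset_left)
      (fun x hx => ?_) ⟨hy₀, Metric.mem_ball_self hρ⟩ hy
    have := hvε x (hδv ⟨Metric.ball_subset_ball (min_le_right r δ) hx.2, hx.1⟩) t ht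
    rw [← dist_eq_norm]
    exact le_of_lt this
  have heq : (∫ t in (0 : ℝ)..1, F (t, y)) - (∫ t in (0 : ℝ)..1, F (t, y₀)) -
      (∫ t in (0 : ℝ)..1, partialFDeriv F U (t, y₀)) (y - y₀) =
      ∫ t in (0 : ℝ)..1, (F (t, y) - F (t, y₀) - partialFDeriv F U (t, y₀) (y - y₀)) := by
    rw [intervalIntegral.integral_sub ((hint hy.1).sub (hint hy₀)),
      intervalIntegral.integral_sub (hint hy.1) (hint hy₀),
      ContinuousLinearMap.intervalIntegral_apply hint']
    exact ⟨(ContinuousLinearMap.apply ℝ G (y - y₀)).integrable_comp hint'.1,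
      (ContinuousLinearMap.apply ℝ G (y - y₀)).integrable_comp hint'.2⟩
  rw [heq]
  have := intervalIntegral.norm_integral_le_of_norm_le_const
    (a := (0 : ℝ)) (b := 1) (C := ε * ‖y - y₀‖)
    (f := fun t => F (t, y) - F (t, y₀) - partialFDeriv F U (t, y₀) (y - y₀))
    fun t ht => hle t (by
      rw [uIoc_of_le zero_le_one] at ht
      exact Ioc_subset_Icc_self ht)
  simpa using this

/-- The derivative is again a parametric integral of a smooth function, now with values in `E →L[ℝ]
G`. The induction therefore has to vary `G`, which is why `E` and `G` share a universe. -/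
theorem contDiffOn_integral_slice [CompleteSpace G] (hU : UniqueDiffOn ℝ U)
    (hUc : LocallyConvexSet U) (hF : ContDiffOn ℝ ∞ F (Icc 0 1 ×ˢ U)) :
    ContDiffOn ℝ ∞ (fun y => ∫ t in (0 : ℝ)..1, F (t, y)) U := by
  rw [contDiffOn_infty]
  intro k
  induction k generalizing G with
  | zero =>
    rw [Nat.cast_zero, contDiffOn_zero]
    exact fun y hy => (hasFDerivWithinAt_integral_slice hU hUc hF hy).continuousWithinAt
  | succ k ih =>
    rw [Nat.cast_succ, contDiffOn_succ_iff_hasFDerivWithinAt_of_uniqueDiffOn hU]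
    exact ⟨by simp, _, ih (contDiffOn_partialFDeriv hU hF),
      fun y hy => hasFDerivWithinAt_integral_slice hU hUc hF hy⟩

end ParametricIntegral

/-! ### Smoothness of maps that become smooth after an immersion, boundary points included. -/

section LocalImmersion

variable {W V Z : Type*} [NormedAddCommGroup W] [NormedSpace ℝ W]
  [NormedAddCommGroup V] [NormedSpace ℝ V]
  [NormedAddCommGroup Z] [NormedSpace ℝ Z]
  {F : W → V} {S' : Set W} {w₀ : W}

/-- Near a point where the derivative is injective, a smooth map on a convex set becomes, after
composition with a linear map, a small perturbation of the identity. -/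
theorem exists_linear_perturbation_id [FiniteDimensional ℝ V] (hS' : Convex ℝ S') (hu : UniqueDiffOn ℝ S')
    (hF : ContDiffOn ℝ ∞ F S') (hw₀ : w₀ ∈ S')
    (hinj : Function.Injective (fderivWithin ℝ F S' w₀)) :
    ∃ (P : V →L[ℝ] W) (r : ℝ), 0 < r ∧
      (∀ w ∈ S' ∩ Metric.ball w₀ r,
        ‖P.comp (fderivWithin ℝ F S' w) - ContinuousLinearMap.id ℝ W‖ ≤ 1 / 2) ∧
      ∀ w ∈ S' ∩ Metric.ball w₀ r, ∀ w' ∈ S' ∩ Metric.ball w₀ r,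
        ‖w - w'‖ ≤ 2 * ‖P (F w) - P (F w')‖ := by
  obtain ⟨P₀, hP₀⟩ := LinearMap.exists_leftInverse_of_injective
    (fderivWithin ℝ F S' w₀ : W →ₗ[ℝ] V) (LinearMap.ker_eq_bot.2 hinj)
  let P : V →L[ℝ] W := P₀.toContinuousLinearMap
  have hP : P.comp (fderivWithin ℝ F S' w₀) = ContinuousLinearMap.id ℝ W := by
    ext v
    exact LinearMap.congr_fun hP₀ v
  have hcont : ContinuousOn (fun w => P.comp (fderivWithin ℝ F S' w)) S' :=
    continuousOn_const.clm_comp (hF.continuousOn_fderivWithin hu (by simp))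
  obtain ⟨r, hr, hrb⟩ := Metric.mem_nhdsWithin_iff.1
    (hcont w₀ hw₀ (Metric.ball_mem_nhds _ (show (0 : ℝ) < 1 / 2 by norm_num)))
  have hb : ∀ w ∈ S' ∩ Metric.ball w₀ r,
      ‖P.comp (fderivWithin ℝ F S' w) - ContinuousLinearMap.id ℝ W‖ ≤ 1 / 2 := by
    intro w hw
    have := hrb ⟨hw.2, hw.1⟩
    rw [mem_preimage, Metric.mem_ball, dist_eq_norm] at this
    simp only [hP] at this
    exact this.le
  refine ⟨P, r, hr, hb, fun w hw w' hw' => ?_⟩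
  -- `P ∘ F - id` is `1/2`-Lipschitz on the convex piece; absorbing half of `‖w - w'‖` produces the
  -- constant `2`.
  have h := (hS'.inter (convex_ball w₀ r)).norm_image_sub_le_of_norm_hasFDerivWithin_le'
    (f := fun w => P (F w)) (fun x hx => ((P.hasFDerivAt.comp_hasFDerivWithinAt x
      (hF.differentiableOn (by simp) x hx.1).hasFDerivWithinAt).mono inter_subset_left)) hb hw' hw
  have h1 : ‖w - w'‖ ≤ ‖P (F w) - P (F w')‖ +
      ‖P (F w) - P (F w') - ContinuousLinearMap.id ℝ W (w - w')‖ := by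
    have := norm_sub_le (P (F w) - P (F w'))
      (P (F w) - P (F w') - ContinuousLinearMap.id ℝ W (w - w'))
    simpa using this
  linarith

variable [CompleteSpace W] {P : V →L[ℝ] W} {S : Set Z} {Φ : Z → W} {K : Z → V}

theorem isUnit_of_norm_sub_id_le {A : W →L[ℝ] W}
    (h : ‖A - ContinuousLinearMap.id ℝ W‖ ≤ 1 / 2) : IsUnit A := by
  have : A = 1 - (1 - A) := by abel
  rw [this]
  refine isUnit_one_sub_of_norm_lt_one ?_
  rw [norm_sub_rev]
  exact h.trans_lt (by norm_num)

/-- Formally, `F ∘ Φ = K` forces `Φ' = (P F')⁻¹ P K'`. The lower bound `hl` supplies what is missing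
for a proof: `Φ z' - Φ z = O(z' - z)`, hence continuity of `Φ`, and the remainder of `F` at `Φ z` is
also `o(z' - z)`. No inverse function theorem is involved, so `Φ z` may lie on the boundary of the
domain of `F`. -/
theorem hasFDerivWithinAt_of_comp_immersion {S₁ : Set W} (hS₁ : S₁ ⊆ S')
    (hF : ContDiffOn ℝ ∞ F S')
    (hb : ∀ w ∈ S₁, ‖P.comp (fderivWithin ℝ F S' w) - ContinuousLinearMap.id ℝ W‖ ≤ 1 / 2)
    (hl : ∀ w ∈ S₁, ∀ w' ∈ S₁, ‖w - w'‖ ≤ 2 * ‖P (F w) - P (F w')‖)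
    (hmaps : MapsTo Φ S S₁) (hK : ContDiffOn ℝ ∞ K S) (hFK : ∀ z ∈ S, F (Φ z) = K z)
    {z : Z} (hz : z ∈ S) :
    HasFDerivWithinAt Φ ((Ring.inverse (P.comp (fderivWithin ℝ F S' (Φ z)))).comp
      (P.comp (fderivWithin ℝ K S z))) S z := by
  have hunit := isUnit_of_norm_sub_id_le (hb _ (hmaps hz))
  have hPK : HasFDerivWithinAt (fun z => P (K z)) (P.comp (fderivWithin ℝ K S z)) S z :=
    P.hasFDerivAt.comp_hasFDerivWithinAt z
      (hK.differentiableOn (by simp) z hz).hasFDerivWithinAt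
  have hPF : HasFDerivWithinAt (fun w => P (F w)) (P.comp (fderivWithin ℝ F S' (Φ z))) S' (Φ z) :=
    P.hasFDerivAt.comp_hasFDerivWithinAt _
      (hF.differentiableOn (by simp) _ (hS₁ (hmaps hz))).hasFDerivWithinAt
  set A := P.comp (fderivWithin ℝ F S' (Φ z)) with hA
  set B := P.comp (fderivWithin ℝ K S z) with hB
  have hO : (fun z' => Φ z' - Φ z) =O[𝓝[S] z] fun z' => z' - z := by
    refine Asymptotics.IsBigO.trans ?_ hPK.isBigO_sub
    refine Asymptotics.IsBigO.of_bound 2 ?_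
    filter_upwards [self_mem_nhdsWithin] with z' hz'
    have := hl _ (hmaps hz') _ (hmaps hz)
    rwa [hFK _ hz', hFK _ hz] at this
  have hcont : Tendsto Φ (𝓝[S] z) (𝓝[S'] (Φ z)) := by
    refine tendsto_nhdsWithin_iff.2 ⟨?_, ?_⟩
    · have h0 : Tendsto (fun z' => z' - z) (𝓝[S] z) (𝓝 0) := by
        have : ContinuousWithinAt (fun z' => z' - z) S z := by fun_prop
        simpa [ContinuousWithinAt] using this
      simpa using (hO.trans_tendsto h0).add_const (Φ z)
    · filter_upwards [self_mem_nhdsWithin] with z' hz' using hS₁ (hmaps hz')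
  have h1 := ((hasFDerivWithinAt_iff_isLittleO.1 hPF).comp_tendsto hcont).trans_isBigO hO
  have h2 := (hasFDerivWithinAt_iff_isLittleO.1 hPK).sub h1
  rw [hasFDerivWithinAt_iff_isLittleO]
  -- As `F ∘ Φ = K`, the difference of the two remainders equals `A (Φ z' - Φ z) - B (z' - z)`;
  -- applying the inverse of `A` gives the remainder of `Φ`.
  have h3 := (Ring.inverse A).isBigO_comp (fun z' => P (K z') - P (K z) - B (z' - z) -
    (P (F (Φ z')) - P (F (Φ z)) - A (Φ z' - Φ z))) (𝓝[S] z)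
  refine (h3.trans_isLittleO h2).congr' ?_ EventuallyEq.rfl
  filter_upwards [self_mem_nhdsWithin] with z' hz'
  have hinv : ∀ x, (Ring.inverse A) (A x) = x := fun x => by
    have := Ring.inverse_mul_cancel A hunit
    exact DFunLike.congr_fun this x
  rw [hFK _ hz', hFK _ hz]
  simp only [map_sub, hinv, ContinuousLinearMap.comp_apply]
  abel

/-- Bootstrapping: the formula for the derivative of `Φ` involves `Φ` itself only through smooth
functions, so `C^k` improves to `C^(k+1)`. -/
theorem contDiffOn_of_comp_immersion {S₁ : Set W} (hS₁ : S₁ ⊆ S') (hu : UniqueDiffOn ℝ S')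
    (hF : ContDiffOn ℝ ∞ F S')
    (hb : ∀ w ∈ S₁, ‖P.comp (fderivWithin ℝ F S' w) - ContinuousLinearMap.id ℝ W‖ ≤ 1 / 2)
    (hl : ∀ w ∈ S₁, ∀ w' ∈ S₁, ‖w - w'‖ ≤ 2 * ‖P (F w) - P (F w')‖)
    (hmaps : MapsTo Φ S S₁) (hS : UniqueDiffOn ℝ S)
    (hK : ContDiffOn ℝ ∞ K S) (hFK : ∀ z ∈ S, F (Φ z) = K z) :
    ContDiffOn ℝ ∞ Φ S := by
  have hd := fun z (hz : z ∈ S) =>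
    hasFDerivWithinAt_of_comp_immersion hS₁ hF hb hl hmaps hK hFK hz
  rw [contDiffOn_infty]
  intro k
  induction k with
  | zero =>
    rw [Nat.cast_zero, contDiffOn_zero]
    exact fun z hz => (hd z hz).continuousWithinAt
  | succ k ih =>
    rw [Nat.cast_succ, contDiffOn_succ_iff_hasFDerivWithinAt_of_uniqueDiffOn hS]
    refine ⟨by simp, _, ?_, hd⟩
    have hA : ContDiffOn ℝ k (fun z => P.comp (fderivWithin ℝ F S' (Φ z))) S :=
      contDiffOn_const.clm_comp
        (((hF.fderivWithin hu (m := ∞) (by simp)).of_le (by exact_mod_cast le_top)).comp ih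
          fun z hz => hS₁ (hmaps hz))
    have hinv : ContDiffOn ℝ k
        (fun z => Ring.inverse (P.comp (fderivWithin ℝ F S' (Φ z)))) S := fun z hz => by
      obtain ⟨U, hU⟩ := isUnit_of_norm_sub_id_le (hb _ (hmaps hz))
      have := contDiffAt_ringInverse ℝ (n := k) U
      rw [hU] at this
      exact this.comp_contDiffWithinAt z (hA z hz)
    exact hinv.clm_comp (contDiffOn_const.clm_comp
      ((hK.fderivWithin hS (m := ∞) (by simp)).of_le (by exact_mod_cast le_top)))

end LocalImmersion

/-! ### Smooth functions with values in alternating maps. -/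

section AlternatingCalculus

variable {W V Z : Type*} [NormedAddCommGroup W] [NormedSpace ℝ W]
  [NormedAddCommGroup V] [NormedSpace ℝ V] [NormedAddCommGroup Z] [NormedSpace ℝ Z]
  {k : ℕ} {S : Set Z} {r : WithTop ℕ∞}

/-- A function with values in alternating maps on a finite dimensional space is smooth as soon as its
evaluations are. -/
theorem contDiffOn_alternating_of_apply [FiniteDimensional ℝ W] {B : Z → W [⋀^Fin k]→L[ℝ] ℝ}
    (h : ∀ v, ContDiffOn ℝ r (fun z => B z v) S) : ContDiffOn ℝ r B S := by
  let b := Module.finBasis ℝ W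
  let ev : (W [⋀^Fin k]→L[ℝ] ℝ) →ₗ[ℝ] ((Fin k → Fin (Module.finrank ℝ W)) → ℝ) :=
    { toFun := fun A σ => A fun i => b (σ i)
      map_add' := fun _ _ => rfl
      map_smul' := fun _ _ => rfl }
  have hev : LinearMap.ker ev = ⊥ := by
    refine LinearMap.ker_eq_bot.2 fun A A' hA => ?_
    refine ContinuousAlternatingMap.toContinuousMultilinearMap_injective
      (ContinuousMultilinearMap.toMultilinearMap_injective ?_)
    exact Module.Basis.ext_multilinear (fun _ => b) fun σ => congrFun hA σ
  obtain ⟨P, hP⟩ := LinearMap.exists_leftInverse_of_injective ev hev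
  -- An alternating map is determined linearly by its finitely many values on basis vectors, so a
  -- linear left inverse of `ev` recovers `B` from its evaluations.
  have hB : B = fun z => P.toContinuousLinearMap (ev (B z)) :=
    funext fun z => (LinearMap.congr_fun hP (B z)).symm
  rw [hB]
  exact P.toContinuousLinearMap.contDiff.comp_contDiffOn
    (contDiffOn_pi.2 fun σ => h fun i => b (σ i))

/-- Precomposition with `k` copies of a linear map depends multilinearly on that map, hence
smoothly. -/
theorem ContDiffOn.alternating_comp [FiniteDimensional ℝ W] {A : Z → V [⋀^Fin k]→L[ℝ] ℝ}
    {B : Z → W →L[ℝ] V} (hA : ContDiffOn ℝ r A S) (hB : ContDiffOn ℝ r B S) :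
    ContDiffOn ℝ r (fun z => (A z).compContinuousLinearMap (B z)) S := by
  refine contDiffOn_alternating_of_apply fun v => ?_
  have h1 : ContDiffOn ℝ r (fun z =>
      ContinuousMultilinearMap.compContinuousLinearMapContinuousMultilinear ℝ
        (fun _ : Fin k => W) (fun _ : Fin k => V) ℝ fun _ => B z) S :=
    (ContinuousMultilinearMap.contDiff _).comp_contDiffOn (contDiffOn_pi.2 fun _ => hB)
  have h2 : ContDiffOn ℝ r
      (fun z => ContinuousAlternatingMap.toContinuousMultilinearMapCLM ℝ (A z)) S :=
    (ContinuousLinearMap.contDiff _).comp_contDiffOn hA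
  exact (ContinuousMultilinearMap.apply ℝ (fun _ : Fin k => W) ℝ v).contDiff.comp_contDiffOn
    (h1.clm_apply h2)

end AlternatingCalculus

/-! ### Pullbacks of forms and their exterior derivative. -/

section Pullback

variable {E : Type*} [NormedAddCommGroup E] [NormedSpace ℝ E]
  {H : Type*} [TopologicalSpace H] {I : ModelWithCorners ℝ E H}
  {M : Type*} [TopologicalSpace M] [ChartedSpace H M]
  {W : Type*} [NormedAddCommGroup W] [NormedSpace ℝ W] {k : ℕ}

/-- The pullback of a form on `M` by a map `g : W → M` which matters only on `S ⊆ W`. -/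
def pullbackOn (η : DForm I M k) (g : W → M) (S : Set W) (z : W) : W [⋀^Fin k]→L[ℝ] ℝ :=
  (η (g z)).compContinuousLinearMap (mfderivWithin 𝓘(ℝ, W) I g S z)

/-- All tangent spaces are the model space `E`, so values of a form at points that are equal, but
not definitionally, can be compared without transport. -/
theorem DForm.apply_congr (η : DForm I M k) {x x' : M} (hx : x = x') {v w : Fin k → E}
    (h : v = w) :
    (show E [⋀^Fin k]→L[ℝ] ℝ from η x) v = (show E [⋀^Fin k]→L[ℝ] ℝ from η x') w := by
  subst hx h
  rfl

variable {η : DForm I M k} {g : W → M} {S : Set W} {z : W}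

theorem mfderivWithin_comp_hasFDerivWithinAt {W' : Type*} [NormedAddCommGroup W']
    [NormedSpace ℝ W'] {S' : Set W'} {j : W' → W} {j' : W' →L[ℝ] W} {z' : W'}
    (hg : MDifferentiableWithinAt 𝓘(ℝ, W) I g S (j z'))
    (hj : HasFDerivWithinAt j j' S' z') (hS' : UniqueDiffWithinAt ℝ S' z')
    (hmaps : MapsTo j S' S) (v : W') :
    (mfderivWithin 𝓘(ℝ, W') I (g ∘ j) S' z' v : E) = mfderivWithin 𝓘(ℝ, W) I g S (j z') (j' v) := by
  have := mfderivWithin_comp z' hg hj.differentiableWithinAt.mdifferentiableWithinAt hmaps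
    (uniqueMDiffWithinAt_iff_uniqueDiffWithinAt.2 hS')
  rw [mfderivWithin_eq_fderivWithin, hj.fderivWithin hS'] at this
  exact DFunLike.congr_fun this v

theorem pullbackOn_comp {W' : Type*} [NormedAddCommGroup W'] [NormedSpace ℝ W'] {S' : Set W'}
    {j : W' → W} {j' : W' →L[ℝ] W} {z' : W'}
    (hg : MDifferentiableWithinAt 𝓘(ℝ, W) I g S (j z'))
    (hj : HasFDerivWithinAt j j' S' z') (hS' : UniqueDiffWithinAt ℝ S' z')
    (hmaps : MapsTo j S' S) :
    pullbackOn η (g ∘ j) S' z' = (pullbackOn η g S (j z')).compContinuousLinearMap j' := by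
  ext v
  exact DForm.apply_congr η rfl (funext fun i =>
    mfderivWithin_comp_hasFDerivWithinAt hg hj hS' hmaps (v i))

/-- The derivative of `f ∘ γ` factors through that of `f`, so a form annihilated by `f` stays
annihilated along any family of reparametrizations `γ`, whatever the number of parameters. -/
theorem pullbackOn_comp_eq_zero {E' : Type*} [NormedAddCommGroup E'] [NormedSpace ℝ E']
    {H' : Type*} [TopologicalSpace H'] {J : ModelWithCorners ℝ E' H'}
    {N : Type*} [TopologicalSpace N] [ChartedSpace H' N] {f : N → M} {γ : W → N}
    (hf : MDifferentiableAt J I f (γ z)) (hγ : MDifferentiableWithinAt 𝓘(ℝ, W) J γ S z)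
    (hS : UniqueDiffWithinAt ℝ S z)
    (h0 : (η (f (γ z))).compContinuousLinearMap (mfderiv J I f (γ z)) = 0) :
    pullbackOn η (f ∘ γ) S z = 0 := by
  ext v
  have := mfderiv_comp_mfderivWithin z hf hγ (uniqueMDiffWithinAt_iff_uniqueDiffWithinAt.2 hS)
  have h1 : pullbackOn η (f ∘ γ) S z v = ((η (f (γ z))).compContinuousLinearMap
      (mfderiv J I f (γ z))) (fun i => mfderivWithin 𝓘(ℝ, W) J γ S z (v i)) :=
    DForm.apply_congr η rfl (funext fun i => DFunLike.congr_fun this (v i))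
  rw [h1, h0]
  rfl

variable [IsManifold I ∞ M]

theorem mfderivWithin_eq_extChartAt {x₀ : M} (hx₀ : g z ∈ (extChartAt I x₀).source)
    (hg : MDifferentiableWithinAt 𝓘(ℝ, W) I g S z) (hS : UniqueDiffWithinAt ℝ S z) (v : W) :
    (mfderivWithin 𝓘(ℝ, W) I g S z v : E) =
      mfderivWithin 𝓘(ℝ, E) I (extChartAt I x₀).symm (range I) (extChartAt I x₀ (g z))
        (fderivWithin ℝ (extChartAt I x₀ ∘ g) S z v) := by
  have hφ : MDifferentiableAt I 𝓘(ℝ, E) (extChartAt I x₀) (g z) :=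
    (contMDiffAt_extChartAt' (n := ∞) (by simpa using hx₀)).mdifferentiableAt (by simp)
  rw [← mfderivWithin_eq_fderivWithin,
    mfderiv_comp_mfderivWithin z hφ hg (uniqueMDiffWithinAt_iff_uniqueDiffWithinAt.2 hS)]
  exact (DFunLike.congr_fun
    (mfderivWithin_extChartAt_symm_comp_mfderiv_extChartAt' (I := I) hx₀) _).symm

theorem pullbackOn_eq_chartRep {x₀ : M} (hx₀ : g z ∈ (extChartAt I x₀).source)
    (hg : MDifferentiableWithinAt 𝓘(ℝ, W) I g S z) (hS : UniqueDiffWithinAt ℝ S z) :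
    pullbackOn η g S z = (chartRep η x₀ (extChartAt I x₀ (g z))).compContinuousLinearMap
      (fderivWithin ℝ (extChartAt I x₀ ∘ g) S z) := by
  ext v
  exact DForm.apply_congr η ((extChartAt I x₀).left_inv hx₀).symm
    (funext fun i => mfderivWithin_eq_extChartAt hx₀ hg hS (v i))

/-- Local coordinate expression of a pullback, on a relative neighbourhood of a point. -/
theorem exists_nhds_pullbackOn_eq (hS : UniqueDiffOn ℝ S) (hg : ContMDiffOn 𝓘(ℝ, W) I ∞ g S)
    {z₀ : W} (hz₀ : z₀ ∈ S) :
    ∃ O : Set W, IsOpen O ∧ z₀ ∈ O ∧ ContDiffOn ℝ ∞ (extChartAt I (g z₀) ∘ g) (S ∩ O) ∧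
      ∀ z ∈ S ∩ O, g z ∈ (extChartAt I (g z₀)).source ∧
        pullbackOn η g S z = (chartRep η (g z₀) (extChartAt I (g z₀) (g z))).compContinuousLinearMap
          (fderivWithin ℝ (extChartAt I (g z₀) ∘ g) (S ∩ O) z) := by
  have hn : g ⁻¹' (extChartAt I (g z₀)).source ∈ 𝓝[S] z₀ :=
    (hg.continuousOn z₀ hz₀) (extChartAt_source_mem_nhds (I := I) (g z₀))
  obtain ⟨O, hO, hzO, hsub⟩ := mem_nhdsWithin.1 hn
  have hsub' : ∀ z ∈ S ∩ O, g z ∈ (extChartAt I (g z₀)).source := fun z hz =>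
    hsub ⟨hz.2, hz.1⟩
  refine ⟨O, hO, hzO, ?_, fun z hz => ⟨hsub' z hz, ?_⟩⟩
  · rw [← contMDiffOn_iff_contDiffOn]
    exact contMDiffOn_extChartAt.comp (hg.mono inter_subset_left)
      fun z hz => by simpa using hsub' z hz
  · rw [pullbackOn_eq_chartRep (hsub' z hz) ((hg z hz.1).mdifferentiableWithinAt (by simp))
      (hS z hz.1), fderivWithin_inter (hO.mem_nhds hz.2)]

theorem contDiffOn_pullbackOn [FiniteDimensional ℝ W] (hη : IsSmoothForm η)
    (hS : UniqueDiffOn ℝ S) (hg : ContMDiffOn 𝓘(ℝ, W) I ∞ g S) :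
    ContDiffOn ℝ ∞ (pullbackOn η g S) S := by
  intro z₀ hz₀
  obtain ⟨O, hO, hzO, hφ, heq⟩ := exists_nhds_pullbackOn_eq (η := η) hS hg hz₀
  have h : ContDiffOn ℝ ∞ (pullbackOn η g S) (S ∩ O) := by
    refine ContDiffOn.congr (ContDiffOn.alternating_comp
      ((hη (g z₀)).comp hφ fun z hz => (extChartAt I (g z₀)).map_source (heq z hz).1)
      (hφ.fderivWithin (hS.inter hO) (m := ∞) (by simp))) fun z hz => (heq z hz).2
  exact (contDiffWithinAt_inter (hO.mem_nhds hzO)).1 (h z₀ ⟨hz₀, hzO⟩)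

/-- `extD η` at `g z₀` is computed in the preferred chart around `g z₀`. Expressing the pullback
near `z₀` in this same chart reduces the claim to naturality of `d` between vector spaces, with no
need for chart independence of `extD`. The condition on `closure (interior S)` provides symmetry of
second derivatives at boundary points. -/
theorem extDerivWithin_pullbackOn (hη : IsSmoothForm η)
    (hS : UniqueDiffOn ℝ S) (hSc : S ⊆ closure (interior S))
    (hg : ContMDiffOn 𝓘(ℝ, W) I ∞ g S) {z₀ : W} (hz₀ : z₀ ∈ S) :
    extDerivWithin (pullbackOn η g S) S z₀ = pullbackOn (extD η) g S z₀ := by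
  obtain ⟨O, hO, hzO, hφ, heq⟩ := exists_nhds_pullbackOn_eq (η := η) hS hg hz₀
  have hz : z₀ ∈ S ∩ O := ⟨hz₀, hzO⟩
  have h1 : extDerivWithin (pullbackOn η g S) S z₀ =
      extDerivWithin (pullbackOn η g S) (S ∩ O) z₀ := by
    rw [extDerivWithin, extDerivWithin, fderivWithin_inter (hO.mem_nhds hzO)]
  have hcl : z₀ ∈ closure (interior (S ∩ O)) := by
    rw [interior_inter, hO.interior_eq]
    exact hO.closure_inter ⟨hSc hz₀, hzO⟩
  rw [h1, extDerivWithin_congr' (fun z hz => (heq z hz).2) hz]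
  have := extDerivWithin_pullback (s := S ∩ O) (f := extChartAt I (g z₀) ∘ g)
    (hη.differentiableWithinAt (g z₀)) (hφ z₀ hz)
    (by
      rw [minSmoothness_of_isRCLikeNormedField]
      exact WithTop.coe_le_coe.2 (mod_cast le_top)) (hS.inter hO) hcl hz
    (fun z hz => (extChartAt_target_subset_range (I := I) _)
      ((extChartAt I (g z₀)).map_source (heq z hz).1))
  refine this.trans ?_
  have hφ : MDifferentiableAt I 𝓘(ℝ, E) (extChartAt I (g z₀)) (g z₀) :=
    (contMDiffAt_extChartAt (n := ∞)).mdifferentiableAt (by simp)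
  have h2 : fderivWithin ℝ (extChartAt I (g z₀) ∘ g) (S ∩ O) z₀ =
      (mfderiv I 𝓘(ℝ, E) (extChartAt I (g z₀)) (g z₀)).comp (mfderivWithin 𝓘(ℝ, W) I g S z₀) := by
    rw [fderivWithin_inter (hO.mem_nhds hzO), ← mfderivWithin_eq_fderivWithin]
    exact mfderiv_comp_mfderivWithin z₀ hφ ((hg z₀ hz₀).mdifferentiableWithinAt (by simp))
      (uniqueMDiffWithinAt_iff_uniqueDiffWithinAt.2 (hS z₀ hz₀))
  rw [h2]
  rfl

end Pullback

/-! ### Tangency to embedded submanifolds. -/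

section Tangent

variable {n : ℕ} {X : Type*} [TopologicalSpace X] [ChartedSpace (EuclideanSpace ℝ (Fin (2 * n))) X]
  {W : Type*} [NormedAddCommGroup W] [NormedSpace ℝ W]

/-- Derivatives of a map with values in an embedded submanifold are tangent to it. -/
theorem mfderivWithin_mem_tangentOf {ωX : DForm (𝓡 (2 * n)) X 2} {Λ : Set X}
    (hΛ : IsLagrangianSubmanifold ωX Λ) {g : W → X} {S : Set W} {z : W} (hz : z ∈ S)
    (hS : UniqueDiffWithinAt ℝ S z) (hg : MDifferentiableWithinAt 𝓘(ℝ, W) (𝓡 (2 * n)) g S z)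
    (hmaps : MapsTo g S Λ) (w : W) :
    mfderivWithin 𝓘(ℝ, W) (𝓡 (2 * n)) g S z w ∈ tangentOf (n := n) Λ (g z) := by
  obtain ⟨φ, V, hφV, hφ⟩ := hΛ.embedded _ (hmaps hz)
  refine ⟨φ, V, hφV, hφ, ?_⟩
  have hdφ : MDifferentiableAt (𝓡 (2 * n)) 𝓘(ℝ, EuclideanSpace ℝ (Fin (2 * n))) φ (g z) :=
    (contMDiffAt_of_mem_maximalAtlas hφV.mem_atlas hφ).mdifferentiableAt (by simp)
  have hcomp := mfderiv_comp_mfderivWithin z hdφ hg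
    (uniqueMDiffWithinAt_iff_uniqueDiffWithinAt.2 hS)
  have hdiff : DifferentiableWithinAt ℝ (φ ∘ g) S z :=
    (hdφ.comp_mdifferentiableWithinAt z hg).differentiableWithinAt
  rw [mfderivWithin_eq_fderivWithin] at hcomp
  have hmem : fderivWithin ℝ (φ ∘ g) S z w ∈ V := by
    -- `π` is the projection along `V`, with kernel exactly `V`. In the slice chart `π ∘ φ ∘ g`
    -- vanishes on `S` near `z`, hence so does its derivative.
    let π : EuclideanSpace ℝ (Fin (2 * n)) →L[ℝ] EuclideanSpace ℝ (Fin (2 * n)) :=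
      ContinuousLinearMap.id ℝ _ - V.starProjection
    have hπ : ∀ x, π x = 0 ↔ x ∈ V := fun x => by
      rw [← Submodule.starProjection_eq_self_iff]
      simp only [π, sub_apply, ContinuousLinearMap.id_apply, sub_eq_zero]
      exact eq_comm
    have hev : (fun z' => π ((φ ∘ g) z')) =ᶠ[𝓝[S] z] fun _ => 0 := by
      filter_upwards [self_mem_nhdsWithin,
        hg.continuousWithinAt (φ.open_source.mem_nhds hφ)] with z' hz' hz's
      exact (hπ _).2 ((hφV.mem_iff _ hz's).1 (hmaps hz'))
    have h1 := (π.hasFDerivAt.comp_hasFDerivWithinAt z hdiff.hasFDerivWithinAt).fderivWithin hS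
    have h2 := hev.fderivWithin_eq_of_mem (𝕜 := ℝ) hz
    rw [← hπ]
    have h3 := h1.symm.trans h2
    rw [fderivWithin_const_apply] at h3
    exact DFunLike.congr_fun h3 w
  have := DFunLike.congr_fun hcomp w
  exact (this ▸ hmem : _)

end Tangent

/-- The retraction of the real line onto the unit interval. -/
abbrev projI : ℝ → unitInterval := Set.projIcc 0 1 zero_le_one

theorem projI_coe (t : unitInterval) : projI t = t := projIcc_val zero_le_one t

theorem coe_projI {t : ℝ} (ht : t ∈ Icc (0 : ℝ) 1) : (projI t : ℝ) = t :=
  congrArg Subtype.val (projIcc_of_mem zero_le_one ht)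

theorem integral_unitInterval {G : Type*} [NormedAddCommGroup G] [NormedSpace ℝ G]
    (φ : unitInterval → G) : ∫ t, φ t = ∫ t in (0 : ℝ)..1, φ (projI t) := by
  rw [intervalIntegral.integral_of_le zero_le_one, ← integral_Icc_eq_integral_Ioc,
    ← integral_subtype measurableSet_Icc]
  simp only [projI_coe]

/-! ### Local geometry of the parameter domains. -/

section Domains

theorem Icc_prod_subset_closure_interior {E : Type*} [TopologicalSpace E] {U : Set E}
    (hU : U ⊆ closure (interior U)) :
    Icc (0 : ℝ) 1 ×ˢ U ⊆ closure (interior (Icc (0 : ℝ) 1 ×ˢ U)) := by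
  rw [interior_prod_eq, closure_prod_eq, interior_Icc, closure_Ioo zero_ne_one]
  exact prod_mono_right hU

variable {E : Type*} [NormedAddCommGroup E] [NormedSpace ℝ E]
  {H : Type*} [TopologicalSpace H] (I : ModelWithCorners ℝ E H)
  {M : Type*} [TopologicalSpace M] [ChartedSpace H M]

/-- The target is relatively open in `range I`, which is convex. -/
theorem locallyConvexSet_extChartAt_target (x₀ : M) :
    LocallyConvexSet (extChartAt I x₀).target := by
  intro y hy
  obtain ⟨r, hr, hsub⟩ := Metric.mem_nhdsWithin_iff.1
    (extChartAt_target_mem_nhdsWithin_of_mem (I := I) hy)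
  refine ⟨r, hr, ?_⟩
  have : (extChartAt I x₀).target ∩ Metric.ball y r = range I ∩ Metric.ball y r := by
    ext z
    exact ⟨fun h => ⟨extChartAt_target_subset_range x₀ h.1, h.2⟩,
      fun h => ⟨hsub ⟨h.2, h.1⟩, h.2⟩⟩
  rw [this]
  exact I.convex_range.inter (convex_ball _ _)

theorem mfderivWithin_extChartAt_symm_target [IsManifold I ∞ M] {x₀ : M} {y : E}
    (hy : y ∈ (extChartAt I x₀).target) :
    mfderivWithin 𝓘(ℝ, E) I (extChartAt I x₀).symm (extChartAt I x₀).target y =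
      mfderivWithin 𝓘(ℝ, E) I (extChartAt I x₀).symm (range I) y :=
  ((contMDiffWithinAt_extChartAt_symm_range (n := ∞) x₀ hy).mdifferentiableWithinAt
    (by simp)).mfderivWithin_mono
      (uniqueMDiffWithinAt_iff_uniqueDiffWithinAt.2 (uniqueDiffOn_extChartAt_target x₀ y hy))
      (extChartAt_target_subset_range x₀)

variable {U : Set E}

theorem LocallyConvexSet.Icc_prod (hU : LocallyConvexSet U) :
    LocallyConvexSet (Icc (0 : ℝ) 1 ×ˢ U) := by
  rintro ⟨t, y⟩ ⟨ht, hy⟩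
  obtain ⟨r, hr, hc⟩ := hU y hy
  refine ⟨r, hr, ?_⟩
  rw [← ball_prod_same, prod_inter_prod]
  exact ((convex_Icc 0 1).inter (convex_ball _ _)).prod hc

end Domains

/-! ### Closedness evaluated on constant vector fields. -/

section ClosedTwoForm

variable {W : Type*} [NormedAddCommGroup W] [NormedSpace ℝ W]

/-- Constant vector fields commute, so only the three derivative terms of `dG` survive. -/
theorem cyclic_sum_eq_zero {G : W → W [⋀^Fin 2]→L[ℝ] ℝ} {S : Set W} {z : W}
    (hG : DifferentiableWithinAt ℝ G S z) (hS : UniqueDiffWithinAt ℝ S z)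
    (hd : extDerivWithin G S z = 0) (w₀ w₁ w₂ : W) :
    fderivWithin ℝ (fun z => G z ![w₁, w₂]) S z w₀ - fderivWithin ℝ (fun z => G z ![w₀, w₂]) S z w₁ +
      fderivWithin ℝ (fun z => G z ![w₀, w₁]) S z w₂ = 0 := by
  have h := extDerivWithin_apply hG hS ![w₀, w₁, w₂]
  rw [hd, Fin.sum_univ_three] at h
  have h0 : (0 : Fin 3).removeNth ![w₀, w₁, w₂] = ![w₁, w₂] := by ext i; fin_cases i <;> rfl
  have h1 : (1 : Fin 3).removeNth ![w₀, w₁, w₂] = ![w₀, w₂] := by ext i; fin_cases i <;> rfl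
  have h2 : (2 : Fin 3).removeNth ![w₀, w₁, w₂] = ![w₀, w₁] := by ext i; fin_cases i <;> rfl
  rw [h0, h1, h2] at h
  simp at h
  linarith

end ClosedTwoForm

/-! ### The flux form in charts: integrability, smoothness and closedness. -/

section ChartFamily

variable {n : ℕ} [NeZero n]
  {X : Type*} [TopologicalSpace X] [ChartedSpace (EuclideanSpace ℝ (Fin (2 * n))) X]
  {L : Type*} [TopologicalSpace L] [ChartedSpace (EuclideanHalfSpace n) L]

/-- A family `f : [0, 1] × L → X` read in the chart of `L` around `x₀`. -/
def chartFamily (f : unitInterval × L → X) (x₀ : L) (z : ℝ × EuclideanSpace ℝ (Fin n)) : X :=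
  f (projI z.1, (extChartAt (𝓡∂ n) x₀).symm z.2)

variable (n) in
/-- The domain of definition of `chartFamily f x₀`. -/
abbrev chartDomain (x₀ : L) : Set (ℝ × EuclideanSpace ℝ (Fin n)) :=
  Icc 0 1 ×ˢ (extChartAt (𝓡∂ n) x₀).target

theorem uniqueDiffOn_chartDomain (x₀ : L) : UniqueDiffOn ℝ (chartDomain n x₀) :=
  uniqueDiffOn_Icc_prod (uniqueDiffOn_extChartAt_target x₀)

theorem contMDiff_slice_left {f : unitInterval × L → X}
    (hf : ContMDiff ((𝓡∂ 1).prod (𝓡∂ n)) (𝓡 (2 * n)) ∞ f) (p : L) :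
    ContMDiff (𝓡∂ 1) (𝓡 (2 * n)) ∞ (fun t => f (t, p)) :=
  hf.comp (contMDiff_id.prodMk contMDiff_const)

theorem contMDiff_slice_right {f : unitInterval × L → X}
    (hf : ContMDiff ((𝓡∂ 1).prod (𝓡∂ n)) (𝓡 (2 * n)) ∞ f) (t : unitInterval) :
    ContMDiff (𝓡∂ n) (𝓡 (2 * n)) ∞ (fun p => f (t, p)) :=
  hf.comp (contMDiff_const.prodMk contMDiff_id)

variable [IsManifold (𝓡∂ n) ∞ L]

theorem contMDiffOn_chartParam (x₀ : L) :
    ContMDiffOn 𝓘(ℝ, ℝ × EuclideanSpace ℝ (Fin n)) ((𝓡∂ 1).prod (𝓡∂ n)) ∞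
      (fun z : ℝ × EuclideanSpace ℝ (Fin n) =>
        ((projI z.1, (extChartAt (𝓡∂ n) x₀).symm z.2) : unitInterval × L)) (chartDomain n x₀) := by
  have h1 : ContMDiffOn 𝓘(ℝ, ℝ × EuclideanSpace ℝ (Fin n)) (𝓡∂ 1) ∞
      (fun z : ℝ × EuclideanSpace ℝ (Fin n) => projI z.1) (chartDomain n x₀) :=
    contMDiffOn_projIcc.comp contDiff_fst.contMDiff.contMDiffOn fun z hz => hz.1
  have h2 : ContMDiffOn 𝓘(ℝ, ℝ × EuclideanSpace ℝ (Fin n)) (𝓡∂ n) ∞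
      (fun z : ℝ × EuclideanSpace ℝ (Fin n) => (extChartAt (𝓡∂ n) x₀).symm z.2)
      (chartDomain n x₀) :=
    (contMDiffOn_extChartAt_symm x₀).comp contDiff_snd.contMDiff.contMDiffOn fun z hz => hz.2
  exact h1.prodMk h2

theorem contMDiffOn_chartFamily {f : unitInterval × L → X}
    (hf : ContMDiff ((𝓡∂ 1).prod (𝓡∂ n)) (𝓡 (2 * n)) ∞ f) (x₀ : L) :
    ContMDiffOn 𝓘(ℝ, ℝ × EuclideanSpace ℝ (Fin n)) (𝓡 (2 * n)) ∞ (chartFamily f x₀)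
      (chartDomain n x₀) :=
  hf.comp_contMDiffOn (contMDiffOn_chartParam x₀)

variable {f : unitInterval × L → X} {x₀ : L} {z : ℝ × EuclideanSpace ℝ (Fin n)}

theorem velocity_eq_mfderivWithin (hf : ContMDiff ((𝓡∂ 1).prod (𝓡∂ n)) (𝓡 (2 * n)) ∞ f)
    (hz : z ∈ chartDomain n x₀) :
    (velocity f (projI z.1) ((extChartAt (𝓡∂ n) x₀).symm z.2) : EuclideanSpace ℝ (Fin (2 * n))) =
      mfderivWithin 𝓘(ℝ, ℝ × EuclideanSpace ℝ (Fin n)) (𝓡 (2 * n)) (chartFamily f x₀)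
        (chartDomain n x₀) z (1, 0) := by
  have h1 := mfderivWithin_comp_hasFDerivWithinAt (z' := z.1)
    (j := fun t : ℝ => (t, z.2)) (S' := Icc 0 1)
    ((contMDiffOn_chartFamily hf x₀ z hz).mdifferentiableWithinAt (by simp))
    (hasFDerivAt_prodMk_left z.1 z.2).hasFDerivWithinAt (uniqueDiffOn_Icc zero_lt_one _ hz.1)
    (fun t ht => ⟨ht, hz.2⟩) 1
  refine Eq.trans ?_ h1
  have h2 := mfderivWithin_comp_projIcc_one (I := 𝓡 (2 * n)) (x := (0 : ℝ)) (y := 1)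
    (f := fun t : unitInterval => f (t, (extChartAt (𝓡∂ n) x₀).symm z.2)) (w := projI z.1)
  rw [coe_projI hz.1] at h2
  exact h2.symm

theorem mfderiv_slice_eq_mfderivWithin (hf : ContMDiff ((𝓡∂ 1).prod (𝓡∂ n)) (𝓡 (2 * n)) ∞ f)
    (hz : z ∈ chartDomain n x₀) (v : EuclideanSpace ℝ (Fin n)) :
    (mfderiv (𝓡∂ n) (𝓡 (2 * n)) (fun q : L => f (projI z.1, q)) ((extChartAt (𝓡∂ n) x₀).symm z.2)
      (mfderivWithin 𝓘(ℝ, EuclideanSpace ℝ (Fin n)) (𝓡∂ n) (extChartAt (𝓡∂ n) x₀).symm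
        (range (𝓡∂ n)) z.2 v) : EuclideanSpace ℝ (Fin (2 * n))) =
      mfderivWithin 𝓘(ℝ, ℝ × EuclideanSpace ℝ (Fin n)) (𝓡 (2 * n)) (chartFamily f x₀)
        (chartDomain n x₀) z (0, v) := by
  have hu := uniqueDiffOn_extChartAt_target (I := 𝓡∂ n) x₀ z.2 hz.2
  have h1 := mfderivWithin_comp_hasFDerivWithinAt (z' := z.2)
    (j := fun y : EuclideanSpace ℝ (Fin n) => (z.1, y)) (S' := (extChartAt (𝓡∂ n) x₀).target)
    ((contMDiffOn_chartFamily hf x₀ z hz).mdifferentiableWithinAt (by simp))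
    (hasFDerivAt_prodMk_right z.1 z.2).hasFDerivWithinAt hu
    (fun t ht => ⟨hz.1, ht⟩) v
  refine Eq.trans ?_ h1
  have hφ := (contMDiffWithinAt_extChartAt_symm_target (I := 𝓡∂ n) (n := ∞) x₀
    hz.2).mdifferentiableWithinAt (by simp)
  have h2 := mfderiv_comp_mfderivWithin z.2
    ((contMDiff_slice_right hf (projI z.1) _).mdifferentiableAt (by simp)) hφ
    (uniqueMDiffWithinAt_iff_uniqueDiffWithinAt.2 hu)
  rw [mfderivWithin_extChartAt_symm_target _ hz.2] at h2
  exact (DFunLike.congr_fun h2 v).symm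

/-- The flux integrand read in a chart of `L`. -/
theorem fluxIntegrand_chart (ωX : DForm (𝓡 (2 * n)) X 2)
    (hf : ContMDiff ((𝓡∂ 1).prod (𝓡∂ n)) (𝓡 (2 * n)) ∞ f) (hz : z ∈ chartDomain n x₀)
    (v : Fin 1 → EuclideanSpace ℝ (Fin n)) :
    fluxIntegrand ωX f ((extChartAt (𝓡∂ n) x₀).symm z.2) (projI z.1) (fun i =>
      mfderivWithin 𝓘(ℝ, EuclideanSpace ℝ (Fin n)) (𝓡∂ n) (extChartAt (𝓡∂ n) x₀).symm
        (range (𝓡∂ n)) z.2 (v i)) =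
    pullbackOn ωX (chartFamily f x₀) (chartDomain n x₀) z ![(1, 0), (0, v 0)] := by
  refine DForm.apply_congr ωX rfl (funext fun i => ?_)
  fin_cases i
  · exact velocity_eq_mfderivWithin hf hz
  · exact mfderiv_slice_eq_mfderivWithin hf hz (v 0)

theorem contDiffOn_pullback_chartFamily [IsManifold (𝓡 (2 * n)) ∞ X] {ωX : DForm (𝓡 (2 * n)) X 2}
    (hω : IsSmoothForm ωX) (hf : ContMDiff ((𝓡∂ 1).prod (𝓡∂ n)) (𝓡 (2 * n)) ∞ f) (x₀ : L) :
    ContDiffOn ℝ ∞ (pullbackOn ωX (chartFamily f x₀) (chartDomain n x₀)) (chartDomain n x₀) :=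
  contDiffOn_pullbackOn hω (uniqueDiffOn_chartDomain x₀) (contMDiffOn_chartFamily hf x₀)

theorem contDiffOn_pullback_chartFamily_apply [IsManifold (𝓡 (2 * n)) ∞ X]
    {ωX : DForm (𝓡 (2 * n)) X 2}
    (hω : IsSmoothForm ωX) (hf : ContMDiff ((𝓡∂ 1).prod (𝓡∂ n)) (𝓡 (2 * n)) ∞ f) (x₀ : L)
    (w : Fin 2 → ℝ × EuclideanSpace ℝ (Fin n)) :
    ContDiffOn ℝ ∞ (fun z => pullbackOn ωX (chartFamily f x₀) (chartDomain n x₀) z w)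
      (chartDomain n x₀) :=
  (ContinuousAlternatingMap.apply ℝ _ ℝ w).contDiff.comp_contDiffOn
    (contDiffOn_pullback_chartFamily hω hf x₀)

/-- The flux integrand in terms of the pullback of `ωX` in the preferred chart around `p`. -/
theorem fluxIntegrand_apply (ωX : DForm (𝓡 (2 * n)) X 2)
    (hf : ContMDiff ((𝓡∂ 1).prod (𝓡∂ n)) (𝓡 (2 * n)) ∞ f) (p : L) {t : ℝ} (ht : t ∈ Icc (0 : ℝ) 1)
    (v : Fin 1 → EuclideanSpace ℝ (Fin n)) :
    fluxIntegrand ωX f p (projI t) v =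
      pullbackOn ωX (chartFamily f p) (chartDomain n p) (t, extChartAt (𝓡∂ n) p p)
        ![(1, 0), (0, mfderiv (𝓡∂ n) 𝓘(ℝ, EuclideanSpace ℝ (Fin n)) (extChartAt (𝓡∂ n) p) p (v 0))] := by
  have hz : (t, extChartAt (𝓡∂ n) p p) ∈ chartDomain n p := ⟨ht, mem_extChartAt_target p⟩
  rw [← fluxIntegrand_chart ωX hf hz fun i =>
    mfderiv (𝓡∂ n) 𝓘(ℝ, EuclideanSpace ℝ (Fin n)) (extChartAt (𝓡∂ n) p) p (v i)]
  have h1 : ∀ w : EuclideanSpace ℝ (Fin n),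
      (mfderivWithin 𝓘(ℝ, EuclideanSpace ℝ (Fin n)) (𝓡∂ n) (extChartAt (𝓡∂ n) p).symm
        (range (𝓡∂ n)) (extChartAt (𝓡∂ n) p p)
        (mfderiv (𝓡∂ n) 𝓘(ℝ, EuclideanSpace ℝ (Fin n)) (extChartAt (𝓡∂ n) p) p w) :
        EuclideanSpace ℝ (Fin n)) = w := fun w => DFunLike.congr_fun
    (mfderivWithin_extChartAt_symm_comp_mfderiv_extChartAt' (I := 𝓡∂ n)
      (mem_extChartAt_source p)) w
  have h2 : (extChartAt (𝓡∂ n) p).symm (extChartAt (𝓡∂ n) p p) = p := extChartAt_to_inv p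
  simp only [h1, h2]

variable [IsManifold (𝓡 (2 * n)) ∞ X] {ωX : DForm (𝓡 (2 * n)) X 2}

theorem continuous_fluxIntegrand (hω : IsSmoothForm ωX)
    (hf : ContMDiff ((𝓡∂ 1).prod (𝓡∂ n)) (𝓡 (2 * n)) ∞ f) (p : L) :
    Continuous (fluxIntegrand ωX f p) := by
  have h : ContDiffOn ℝ 0 (fun t : ℝ => fluxIntegrand ωX f p (projI t)) (Icc 0 1) := by
    refine contDiffOn_alternating_of_apply fun v => contDiffOn_zero.2 ?_
    refine ContinuousOn.congr ?_ fun t ht => fluxIntegrand_apply ωX hf p ht v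
    exact (contDiffOn_pullback_chartFamily_apply hω hf p _).continuousOn.comp (by fun_prop)
      fun t ht => ⟨ht, mem_extChartAt_target p⟩
  have h' := h.continuousOn.comp_continuous continuous_subtype_val fun t : unitInterval => t.2
  simpa only [Function.comp_def, projI_coe] using h'

theorem integrable_fluxIntegrand (hω : IsSmoothForm ωX)
    (hf : ContMDiff ((𝓡∂ 1).prod (𝓡∂ n)) (𝓡 (2 * n)) ∞ f) (p : L) :
    Integrable (fluxIntegrand ωX f p) :=
  (continuous_fluxIntegrand hω hf p).integrable_of_hasCompactSupport
    (HasCompactSupport.of_compactSpace _)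

theorem fluxForm_apply (hω : IsSmoothForm ωX)
    (hf : ContMDiff ((𝓡∂ 1).prod (𝓡∂ n)) (𝓡 (2 * n)) ∞ f) (p : L)
    (v : Fin 1 → EuclideanSpace ℝ (Fin n)) :
    (show EuclideanSpace ℝ (Fin n) [⋀^Fin 1]→L[ℝ] ℝ from fluxForm ωX f p) v =
      ∫ t in (0 : ℝ)..1, fluxIntegrand ωX f p (projI t) v := by
  rw [← integral_unitInterval fun t => fluxIntegrand ωX f p t v]
  exact ((ContinuousAlternatingMap.apply ℝ (EuclideanSpace ℝ (Fin n)) ℝ v).integral_comp_comm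
    (integrable_fluxIntegrand hω hf p)).symm

/-- The flux form read in a chart of `L`. -/
theorem chartRep_fluxForm (hω : IsSmoothForm ωX)
    (hf : ContMDiff ((𝓡∂ 1).prod (𝓡∂ n)) (𝓡 (2 * n)) ∞ f) {y : EuclideanSpace ℝ (Fin n)}
    (hy : y ∈ (extChartAt (𝓡∂ n) x₀).target) (v : Fin 1 → EuclideanSpace ℝ (Fin n)) :
    chartRep (fluxForm ωX f) x₀ y v = ∫ t in (0 : ℝ)..1,
      pullbackOn ωX (chartFamily f x₀) (chartDomain n x₀) (t, y) ![(1, 0), (0, v 0)] := by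
  refine (fluxForm_apply hω hf _ _).trans (intervalIntegral.integral_congr fun t ht => ?_)
  rw [uIcc_of_le zero_le_one] at ht
  exact fluxIntegrand_chart ωX hf (z := (t, y)) ⟨ht, hy⟩ v

theorem isSmoothForm_fluxForm (hω : IsSmoothForm ωX)
    (hf : ContMDiff ((𝓡∂ 1).prod (𝓡∂ n)) (𝓡 (2 * n)) ∞ f) : IsSmoothForm (fluxForm ωX f) := by
  intro x₀
  refine contDiffOn_alternating_of_apply fun v => ?_
  refine ContDiffOn.congr ?_ fun y hy => chartRep_fluxForm hω hf hy v
  exact contDiffOn_integral_slice (uniqueDiffOn_extChartAt_target x₀)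
    (locallyConvexSet_extChartAt_target _ x₀) (contDiffOn_pullback_chartFamily_apply hω hf x₀ _)

theorem fderivWithin_chartRep_fluxForm (hω : IsSmoothForm ωX)
    (hf : ContMDiff ((𝓡∂ 1).prod (𝓡∂ n)) (𝓡 (2 * n)) ∞ f) (x₀ : L)
    (v : Fin 1 → EuclideanSpace ℝ (Fin n)) (w : EuclideanSpace ℝ (Fin n)) :
    fderivWithin ℝ (fun y => chartRep (fluxForm ωX f) x₀ y v) (range (𝓡∂ n))
      (extChartAt (𝓡∂ n) x₀ x₀) w = ∫ t in (0 : ℝ)..1,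
        fderivWithin ℝ (fun z => pullbackOn ωX (chartFamily f x₀) (chartDomain n x₀) z
          ![(1, 0), (0, v 0)]) (chartDomain n x₀) (t, extChartAt (𝓡∂ n) x₀ x₀) (0, w) := by
  have hu := uniqueDiffOn_extChartAt_target (I := 𝓡∂ n) x₀
  have hF := contDiffOn_pullback_chartFamily_apply hω hf x₀ ![(1, 0), (0, v 0)]
  have hd := hasFDerivWithinAt_integral_slice hu (locallyConvexSet_extChartAt_target _ x₀) hF
    (mem_extChartAt_target x₀)
  have hd' := (hd.congr (f₁ := fun y => chartRep (fluxForm ωX f) x₀ y v)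
    (fun y hy => chartRep_fluxForm hω hf hy v)
    (chartRep_fluxForm hω hf (mem_extChartAt_target x₀) v)).mono_of_mem_nhdsWithin (extChartAt_target_mem_nhdsWithin x₀)
  rw [hd'.fderivWithin ((𝓡∂ n).uniqueDiffOn _ (by simp [extChartAt])),
    ContinuousLinearMap.intervalIntegral_apply
      (intervalIntegrable_slice (contDiffOn_partialFDeriv hu hF).continuousOn
        (mem_extChartAt_target x₀))]
  rfl

/-- With `Θ` the pullback of `ωX` to `[0, 1] × L`, closedness amounts to symmetry in `v 0, v 1` of
the derivative of `Θ(∂_t, ·)`, and this symmetry already holds for each `t` before integration. -/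
theorem extD_fluxForm (hω : IsSmoothForm ωX) (hdω : extD ωX = 0)
    (hf : ContMDiff ((𝓡∂ 1).prod (𝓡∂ n)) (𝓡 (2 * n)) ∞ f)
    (hlag : ∀ t p, (ωX (f (t, p))).compContinuousLinearMap
      (mfderiv (𝓡∂ n) (𝓡 (2 * n)) (fun q => f (t, q)) p) = 0) : extD (fluxForm ωX f) = 0 := by
  funext x
  have hu := uniqueDiffOn_chartDomain (n := n) x
  have hG := contDiffOn_pullback_chartFamily hω hf x
  have key : extDerivWithin (chartRep (fluxForm ωX f) x) (range (𝓡∂ n))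
      (extChartAt (𝓡∂ n) x x) = 0 := by
    ext v
    rw [extDerivWithin_apply ((isSmoothForm_fluxForm hω hf).differentiableWithinAt x)
      ((𝓡∂ n).uniqueDiffOn _ (by simp [extChartAt])), Fin.sum_univ_two,
      fderivWithin_chartRep_fluxForm hω hf, fderivWithin_chartRep_fluxForm hω hf]
    have h0 : (0 : Fin 2).removeNth v 0 = v 1 := rfl
    have h1 : (1 : Fin 2).removeNth v 0 = v 0 := rfl
    rw [h0, h1]
    have hEq : ∀ t ∈ Icc (0 : ℝ) 1,
        fderivWithin ℝ (fun z => pullbackOn ωX (chartFamily f x) (chartDomain n x) z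
          ![(1, 0), (0, v 1)]) (chartDomain n x) (t, extChartAt (𝓡∂ n) x x) (0, v 0) =
        fderivWithin ℝ (fun z => pullbackOn ωX (chartFamily f x) (chartDomain n x) z
          ![(1, 0), (0, v 0)]) (chartDomain n x) (t, extChartAt (𝓡∂ n) x x) (0, v 1) := by
      intro t ht
      have hz : (t, extChartAt (𝓡∂ n) x x) ∈ chartDomain n x := ⟨ht, mem_extChartAt_target x⟩
      -- The identity `dΘ(∂_t, v 0, v 1) = 0`; its only term that is not a derivative of `Θ(∂_t, ·)`
      -- is `∂_t Θ(v 0, v 1)`.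
      have hc := cyclic_sum_eq_zero (hG.differentiableOn (by simp) _ hz) (hu _ hz)
        (by
          rw [extDerivWithin_pullbackOn hω hu (Icc_prod_subset_closure_interior
            extChartAt_target_subset_closure_interior) (contMDiffOn_chartFamily hf x) hz, hdω]
          rfl) (1, 0) (0, v 0) (0, v 1)
      -- The Lagrangian condition: `Θ` vanishes identically on pairs of vectors tangent to the
      -- slices, so `∂_t Θ(v 0, v 1) = 0`.
      have hvan : EqOn (fun z => pullbackOn ωX (chartFamily f x) (chartDomain n x) z
          ![(0, v 0), (0, v 1)]) (fun _ => 0) (chartDomain n x) := by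
        intro z hz
        have h1 : pullbackOn ωX (chartFamily f x) (chartDomain n x) z ![(0, v 0), (0, v 1)] =
            ((ωX (f (projI z.1, (extChartAt (𝓡∂ n) x).symm z.2))).compContinuousLinearMap
              (mfderiv (𝓡∂ n) (𝓡 (2 * n)) (fun q => f (projI z.1, q))
                ((extChartAt (𝓡∂ n) x).symm z.2)))
              (fun i => mfderivWithin 𝓘(ℝ, EuclideanSpace ℝ (Fin n)) (𝓡∂ n)
                (extChartAt (𝓡∂ n) x).symm (range (𝓡∂ n)) z.2 (v i)) := by
          refine DForm.apply_congr ωX rfl (funext fun i => ?_)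
          fin_cases i
          · exact (mfderiv_slice_eq_mfderivWithin hf hz (v 0)).symm
          · exact (mfderiv_slice_eq_mfderivWithin hf hz (v 1)).symm
        rw [hlag] at h1
        exact h1
      rw [fderivWithin_congr hvan (hvan hz), fderivWithin_const_apply] at hc
      simp only [zero_apply] at hc
      linarith
    rw [intervalIntegral.integral_congr (g := fun t =>
      fderivWithin ℝ (fun z => pullbackOn ωX (chartFamily f x) (chartDomain n x) z
          ![(1, 0), (0, v 0)]) (chartDomain n x) (t, extChartAt (𝓡∂ n) x x) (0, v 1))
      fun t ht => hEq t (by rwa [uIcc_of_le zero_le_one] at ht)]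
    simp
  simp only [extD, key]
  rfl

end ChartFamily

/-! ### Vanishing of the flux form on the boundary. -/

section BoundaryValues

theorem tangentOf_congr {n : ℕ} {X : Type*} [TopologicalSpace X]
    [ChartedSpace (EuclideanSpace ℝ (Fin (2 * n))) X] {Λ : Set X} {q q' : X} (hq : q = q')
    {v : TangentSpace (𝓡 (2 * n)) q} {v' : TangentSpace (𝓡 (2 * n)) q'}
    (hv : (v : EuclideanSpace ℝ (Fin (2 * n))) = v') (h : v ∈ tangentOf (n := n) Λ q) :
    v' ∈ tangentOf (n := n) Λ q' := by
  subst hq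
  exact hv ▸ h

variable {n : ℕ} [NeZero n]
  {X : Type*} [TopologicalSpace X] [ChartedSpace (EuclideanSpace ℝ (Fin (2 * n))) X]
  {L : Type*} [TopologicalSpace L] [ChartedSpace (EuclideanHalfSpace n) L]

theorem IsBoundaryEnumeration.exists_eq {d : ℕ} {C : Fin d → Set L}
    (hC : IsBoundaryEnumeration n C) {p : L} (hp : p ∈ (𝓡∂ n).boundary L) :
    ∃ i, C i = connectedComponentIn ((𝓡∂ n).boundary L) p := by
  have : connectedComponentIn ((𝓡∂ n).boundary L) p ∈ range C := by
    rw [hC.2]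
    exact ⟨p, hp, rfl⟩
  exact this

theorem velocity_mem_tangentOf {ωX : DForm (𝓡 (2 * n)) X 2} {Λ : Set X}
    (hΛ : IsLagrangianSubmanifold ωX Λ) {f : unitInterval × L → X}
    (hf : ContMDiff ((𝓡∂ 1).prod (𝓡∂ n)) (𝓡 (2 * n)) ∞ f) {p : L} (hp : ∀ t, f (t, p) ∈ Λ)
    (t : unitInterval) : velocity f t p ∈ tangentOf (n := n) Λ (f (t, p)) := by
  have h1 : ContMDiffOn 𝓘(ℝ, ℝ) (𝓡 (2 * n)) ∞ ((fun s : unitInterval => f (s, p)) ∘ projI)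
      (Icc 0 1) := (contMDiff_slice_left hf p).comp_contMDiffOn contMDiffOn_projIcc
  have h2 := mfderivWithin_mem_tangentOf hΛ t.2 (uniqueDiffOn_Icc zero_lt_one _ t.2)
    ((h1 t t.2).mdifferentiableWithinAt (by simp)) (fun s _ => hp _) 1
  refine tangentOf_congr (congrArg (fun s => f (s, p)) (projI_coe t)) ?_ h2
  exact mfderivWithin_comp_projIcc_one (I := 𝓡 (2 * n)) (x := (0 : ℝ)) (y := 1)
    (f := fun s : unitInterval => f (s, p)) (w := t)

variable [IsManifold (𝓡∂ n) ∞ L]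

/-- The straight line in the chart around a boundary point, in a direction tangent to the boundary,
stays in the boundary component for a short time. -/
theorem exists_ball_line_mem_component {p : L} (hp : p ∈ (𝓡∂ n).boundary L)
    {v : EuclideanSpace ℝ (Fin n)} (hv : v 0 = 0) :
    ∃ ε > 0, ∀ s ∈ Metric.ball (0 : ℝ) ε,
      extChartAt (𝓡∂ n) p p + s • v ∈ (extChartAt (𝓡∂ n) p).target ∧
      (extChartAt (𝓡∂ n) p).symm (extChartAt (𝓡∂ n) p p + s • v) ∈
        connectedComponentIn ((𝓡∂ n).boundary L) p := by
  set φ := extChartAt (𝓡∂ n) p with hφ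
  have h0 : φ p 0 = 0 := by
    have : φ p ∈ frontier (range (𝓡∂ n)) := hp
    rw [frontier_range_modelWithCornersEuclideanHalfSpace] at this
    exact this.symm
  have hline : ∀ s : ℝ, φ p + s • v ∈ frontier (range (𝓡∂ n)) := fun s => by
    rw [frontier_range_modelWithCornersEuclideanHalfSpace]
    simp [h0, hv]
  have hrange : ∀ s : ℝ, φ p + s • v ∈ range (𝓡∂ n) := fun s =>
    (𝓡∂ n).isClosed_range.frontier_subset (hline s)
  have hcont : Continuous fun s : ℝ => φ p + s • v := by fun_prop
  have hmem : (fun s : ℝ => φ p + s • v) ⁻¹' φ.target ∈ 𝓝 (0 : ℝ) := by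
    have ht : Tendsto (fun s : ℝ => φ p + s • v) (𝓝 0) (𝓝[range (𝓡∂ n)] (φ p)) := by
      refine tendsto_nhdsWithin_iff.2 ⟨?_, Eventually.of_forall hrange⟩
      simpa using hcont.tendsto 0
    exact ht (extChartAt_target_mem_nhdsWithin p)
  obtain ⟨ε, hε, hball⟩ := Metric.mem_nhds_iff.1 hmem
  refine ⟨ε, hε, fun s hs => ⟨hball hs, ?_⟩⟩
  -- A connected subset of `∂L` through `p` lies in the component of `p`; it remains to see that the
  -- line stays in `∂L`.
  have hpre : IsPreconnected ((fun s : ℝ => φ.symm (φ p + s • v)) '' Metric.ball 0 ε) := by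
    refine (convex_ball (0 : ℝ) ε).isPreconnected.image _ ?_
    exact (continuousOn_extChartAt_symm p).comp hcont.continuousOn fun s hs => hball hs
  have hsub : (fun s : ℝ => φ.symm (φ p + s • v)) '' Metric.ball 0 ε ⊆ (𝓡∂ n).boundary L := by
    rintro _ ⟨s, hs, rfl⟩
    have hsrc : φ.symm (φ p + s • v) ∈ φ.source := φ.map_target (hball hs)
    -- Being a boundary point can be tested in any chart, so the chart around `p` serves for all
    -- nearby points of the line.
    refine (ModelWithCorners.isBoundaryPoint_iff_of_mem_atlas (n := ∞) (by simp)
      (chart_mem_atlas _ p) (by simpa [φ] using hsrc)).2 ?_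
    have hr : φ (φ.symm (φ p + s • v)) = φ p + s • v := φ.right_inv (hball hs)
    change φ (φ.symm (φ p + s • v)) ∈ frontier φ.target
    rw [hr]
    exact ⟨subset_closure (hball hs),
      fun h => (hline s).2 (interior_mono (extChartAt_target_subset_range p) h)⟩
  refine hpre.subset_connectedComponentIn ⟨0, Metric.mem_ball_self hε, ?_⟩ hsub ⟨s, hs, rfl⟩
  simp only [zero_smul, add_zero]
  exact extChartAt_to_inv p

/-- `v` is the velocity of a coordinate line inside the boundary component. The image of this line
under `f` is a curve in `Λ` with velocity `df(v)`. -/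
theorem mfderiv_mem_tangentOf_of_boundaryTangent {ωX : DForm (𝓡 (2 * n)) X 2} {Λ : Set X}
    (hΛ : IsLagrangianSubmanifold ωX Λ) {f : L → X} (hf : ContMDiff (𝓡∂ n) (𝓡 (2 * n)) ∞ f)
    {p : L} (hp : p ∈ (𝓡∂ n).boundary L)
    (hfΛ : ∀ q ∈ connectedComponentIn ((𝓡∂ n).boundary L) p, f q ∈ Λ)
    {v : TangentSpace (𝓡∂ n) p} (hv : v ∈ boundaryTangent p) :
    mfderiv (𝓡∂ n) (𝓡 (2 * n)) f p v ∈ tangentOf (n := n) Λ (f p) := by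
  set v' : EuclideanSpace ℝ (Fin n) :=
    mfderiv (𝓡∂ n) 𝓘(ℝ, EuclideanSpace ℝ (Fin n)) (extChartAt (𝓡∂ n) p) p v with hv'
  obtain ⟨ε, hε, hball⟩ := exists_ball_line_mem_component hp (v := v') hv
  have hφ : ContMDiffOn 𝓘(ℝ, EuclideanSpace ℝ (Fin n)) (𝓡 (2 * n)) ∞
      (f ∘ (extChartAt (𝓡∂ n) p).symm) (extChartAt (𝓡∂ n) p).target :=
    hf.comp_contMDiffOn (contMDiffOn_extChartAt_symm p)
  have hc : HasFDerivWithinAt (fun s : ℝ => extChartAt (𝓡∂ n) p p + s • v')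
      (ContinuousLinearMap.toSpanSingleton ℝ v') (Metric.ball 0 ε) 0 :=
    ((ContinuousLinearMap.toSpanSingleton ℝ v').hasFDerivAt.const_add _).hasFDerivWithinAt
  have h0 : (0 : ℝ) ∈ Metric.ball (0 : ℝ) ε := Metric.mem_ball_self hε
  have hp0 : extChartAt (𝓡∂ n) p p + (0 : ℝ) • v' = extChartAt (𝓡∂ n) p p := by simp
  have hu : UniqueDiffWithinAt ℝ (Metric.ball (0 : ℝ) ε) 0 := Metric.isOpen_ball.uniqueDiffOn 0 h0
  have hd : MDifferentiableWithinAt 𝓘(ℝ, EuclideanSpace ℝ (Fin n)) (𝓡 (2 * n))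
      (f ∘ (extChartAt (𝓡∂ n) p).symm) (extChartAt (𝓡∂ n) p).target
      (extChartAt (𝓡∂ n) p p + (0 : ℝ) • v') :=
    (hφ _ (hball 0 h0).1).mdifferentiableWithinAt (by simp)
  have hmaps : MapsTo (fun s : ℝ => extChartAt (𝓡∂ n) p p + s • v') (Metric.ball 0 ε)
      (extChartAt (𝓡∂ n) p).target := fun s hs => (hball s hs).1
  have hd' := hd.comp (I := 𝓘(ℝ, ℝ)) (0 : ℝ) hc.differentiableWithinAt.mdifferentiableWithinAt hmaps
  have hmem := mfderivWithin_mem_tangentOf hΛ h0 hu hd' (fun s hs => hfΛ _ (hball s hs).2) 1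
  have hval := mfderivWithin_comp_hasFDerivWithinAt (z' := (0 : ℝ))
    (j := fun s : ℝ => extChartAt (𝓡∂ n) p p + s • v') hd hc hu hmaps 1
  refine tangentOf_congr ?_ (hval.trans ?_) hmem
  · exact congrArg f ((congrArg _ hp0).trans (extChartAt_to_inv p))
  · have h1 : (ContinuousLinearMap.toSpanSingleton ℝ v' 1 : EuclideanSpace ℝ (Fin n)) = v' := by
      simp
    rw [h1, hp0]
    have hu' := uniqueDiffOn_extChartAt_target (I := 𝓡∂ n) p _ (mem_extChartAt_target p)
    have hs := (contMDiffWithinAt_extChartAt_symm_target (I := 𝓡∂ n) (n := ∞) p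
      (mem_extChartAt_target p)).mdifferentiableWithinAt (by simp)
    rw [mfderiv_comp_mfderivWithin_of_eq ((hf p).mdifferentiableAt (by simp)) hs
      (uniqueMDiffWithinAt_iff_uniqueDiffWithinAt.2 hu') (extChartAt_to_inv p)]
    have h2 := mfderivWithin_extChartAt_symm_target (𝓡∂ n) (mem_extChartAt_target (I := 𝓡∂ n) p)
    exact congrArg (mfderiv (𝓡∂ n) (𝓡 (2 * n)) f p) ((DFunLike.congr_fun h2 v').trans
      (DFunLike.congr_fun (mfderivWithin_extChartAt_symm_comp_mfderiv_extChartAt' (I := 𝓡∂ n)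
        (mem_extChartAt_source p)) v))

/-- For `p` in `C i`, the curve `t ↦ f (t, p)` stays in `Λ i`, so the velocity is tangent to `Λ i`,
as is the image of any vector tangent to `∂L`. The integrand vanishes since `Λ i` is isotropic. -/
theorem vanishesOnBoundary_fluxForm [IsManifold (𝓡 (2 * n)) ∞ X] {ωX : DForm (𝓡 (2 * n)) X 2}
    (hω : IsSmoothForm ωX) {d : ℕ} {C : Fin d → Set L} (hC : IsBoundaryEnumeration n C)
    {Λ : Fin d → Set X} (hΛ : ∀ i, IsLagrangianSubmanifold ωX (Λ i)) {f : unitInterval × L → X}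
    (hf : ContMDiff ((𝓡∂ 1).prod (𝓡∂ n)) (𝓡 (2 * n)) ∞ f)
    (hb : ∀ t i, ∀ p ∈ C i, f (t, p) ∈ Λ i) : VanishesOnBoundary (fluxForm ωX f) := by
  intro p hp v hv
  obtain ⟨i, hi⟩ := hC.exists_eq hp
  refine (fluxForm_apply hω hf p v).trans ?_
  refine (intervalIntegral.integral_congr (g := fun _ => 0) fun t _ => ?_).trans (by simp)
  have hpC : p ∈ C i := hi ▸ mem_connectedComponentIn hp
  have h := (hΛ i).isotropic _ (hb (projI t) i p hpC) _
    (velocity_mem_tangentOf (hΛ i) hf (fun t => hb t i p hpC) (projI t)) _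
    (mfderiv_mem_tangentOf_of_boundaryTangent (hΛ i) (contMDiff_slice_right hf (projI t)) hp
      (fun q hq => hb _ i q (hi ▸ hq)) (hv 0))
  refine Eq.trans (DForm.apply_congr ωX rfl (funext fun j => ?_)) h
  fin_cases j <;> rfl

end BoundaryValues

/-! ### The homotopy formula in coordinates. -/

section SliceCalculus

universe u

variable {E G : Type u} [NormedAddCommGroup E] [NormedSpace ℝ E] [NormedAddCommGroup G]
  [NormedSpace ℝ G] {U : Set E} {F : ℝ × E → G}

theorem fderivWithin_integral_slice_apply [CompleteSpace G] (hU : UniqueDiffOn ℝ U)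
    (hUc : LocallyConvexSet U) (hF : ContDiffOn ℝ ∞ F (Icc 0 1 ×ˢ U)) {y : E} (hy : y ∈ U) (w : E) :
    fderivWithin ℝ (fun y => ∫ t in (0 : ℝ)..1, F (t, y)) U y w =
      ∫ t in (0 : ℝ)..1, fderivWithin ℝ F (Icc 0 1 ×ˢ U) (t, y) (0, w) := by
  rw [(hasFDerivWithinAt_integral_slice hU hUc hF hy).fderivWithin (hU y hy),
    ContinuousLinearMap.intervalIntegral_apply
      (intervalIntegrable_slice (contDiffOn_partialFDeriv hU hF).continuousOn hy)]
  rfl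

theorem intervalIntegrable_fderivWithin_slice (hU : UniqueDiffOn ℝ U)
    (hF : ContDiffOn ℝ ∞ F (Icc 0 1 ×ˢ U)) {y : E} (hy : y ∈ U) (w : ℝ × E) :
    IntervalIntegrable (fun t => fderivWithin ℝ F (Icc 0 1 ×ˢ U) (t, y) w) volume 0 1 :=
  intervalIntegrable_slice (F := fun z => fderivWithin ℝ F (Icc 0 1 ×ˢ U) z w)
    ((hF.continuousOn_fderivWithin (uniqueDiffOn_Icc_prod hU) (by simp)).clm_apply
      continuousOn_const) hy

theorem integral_fderivWithin_slice [CompleteSpace G] (hU : UniqueDiffOn ℝ U)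
    (hF : ContDiffOn ℝ ∞ F (Icc 0 1 ×ˢ U)) {y : E} (hy : y ∈ U) :
    ∫ t in (0 : ℝ)..1, fderivWithin ℝ F (Icc 0 1 ×ˢ U) (t, y) (1, 0) = F (1, y) - F (0, y) := by
  have hd : ∀ t ∈ Icc (0 : ℝ) 1, HasDerivWithinAt (fun t => F (t, y))
      (fderivWithin ℝ F (Icc 0 1 ×ˢ U) (t, y) (1, 0)) (Icc 0 1) t := fun t ht => by
    have h1 : HasFDerivWithinAt (fun s : ℝ => (s, y)) (ContinuousLinearMap.inl ℝ ℝ E) (Icc 0 1) t :=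
      (hasFDerivAt_prodMk_left t y).hasFDerivWithinAt
    have h2 : MapsTo (fun s : ℝ => (s, y)) (Icc 0 1) (Icc 0 1 ×ˢ U) := fun s hs => ⟨hs, hy⟩
    exact (((hF.differentiableOn (by simp)) (t, y) ⟨ht, hy⟩).hasFDerivWithinAt.comp t h1
      h2).hasDerivWithinAt
  refine intervalIntegral.integral_eq_sub_of_hasDeriv_right (f := fun t => F (t, y)) ?_ ?_
    (intervalIntegrable_fderivWithin_slice hU hF hy _)
  · rw [uIcc_of_le zero_le_one]
    exact fun t ht => (hd t ht).continuousWithinAt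
  · intro t ht
    rw [min_eq_left zero_le_one, max_eq_right zero_le_one] at ht
    exact ((hd t (Ioo_subset_Icc_self ht)).hasDerivAt
      (Icc_mem_nhds ht.1 ht.2)).hasDerivWithinAt

/-- The homotopy formula for a closed two-form on a product `[0, 1] × [0, 1] × U`. -/
theorem fderivWithin_double_integral {E : Type} [NormedAddCommGroup E] [NormedSpace ℝ E]
    {U : Set E} (hU : UniqueDiffOn ℝ U)
    (hUc : LocallyConvexSet U) {Θ : ℝ × ℝ × E → (ℝ × ℝ × E) [⋀^Fin 2]→L[ℝ] ℝ}
    (hΘ : ContDiffOn ℝ ∞ Θ (Icc 0 1 ×ˢ Icc 0 1 ×ˢ U))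
    (hd : ∀ z ∈ Icc (0 : ℝ) 1 ×ˢ Icc (0 : ℝ) 1 ×ˢ U,
      extDerivWithin Θ (Icc 0 1 ×ˢ Icc 0 1 ×ˢ U) z = 0)
    {y : E} (hy : y ∈ U) (v : E)
    (h0 : ∀ u ∈ Icc (0 : ℝ) 1, Θ (u, 0, y) ![(1, 0, 0), (0, 0, v)] = 0)
    (h1 : ∀ u ∈ Icc (0 : ℝ) 1, Θ (u, 1, y) ![(1, 0, 0), (0, 0, v)] = 0) :
    fderivWithin ℝ (fun y => ∫ t in (0 : ℝ)..1, ∫ u in (0 : ℝ)..1,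
        Θ (u, t, y) ![(1, 0, 0), (0, 1, 0)]) U y v =
      (∫ t in (0 : ℝ)..1, Θ (0, t, y) ![(0, 1, 0), (0, 0, v)]) -
        ∫ t in (0 : ℝ)..1, Θ (1, t, y) ![(0, 1, 0), (0, 0, v)] := by
  have hU2 := uniqueDiffOn_Icc_prod hU
  have hU3 := uniqueDiffOn_Icc_prod hU2
  have hsm : ∀ w : Fin 2 → ℝ × ℝ × E, ContDiffOn ℝ ∞ (fun z => Θ z w)
      (Icc 0 1 ×ˢ Icc 0 1 ×ˢ U) := fun w =>
    (ContinuousAlternatingMap.apply ℝ _ ℝ w).contDiff.comp_contDiffOn hΘ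
  have hK : ∀ w : Fin 2 → ℝ × ℝ × E, ContDiffOn ℝ ∞
      (fun z : ℝ × E => ∫ u in (0 : ℝ)..1, Θ (u, z) w) (Icc 0 1 ×ˢ U) := fun w =>
    contDiffOn_integral_slice hU2 hUc.Icc_prod (hsm w)
  rw [fderivWithin_integral_slice_apply hU hUc (hK _) hy]
  -- The identity `∂_v Θ(∂_u, ∂_t) = ∂_t Θ(∂_u, v) - ∂_u Θ(∂_t, v)`, integrated over `u`; the last
  -- term integrates to boundary values at `u = 0, 1`.
  have hstep : ∀ t ∈ Icc (0 : ℝ) 1,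
      fderivWithin ℝ (fun z : ℝ × E => ∫ u in (0 : ℝ)..1, Θ (u, z) ![(1, 0, 0), (0, 1, 0)])
        (Icc 0 1 ×ˢ U) (t, y) (0, v) =
      fderivWithin ℝ (fun z : ℝ × E => ∫ u in (0 : ℝ)..1, Θ (u, z) ![(1, 0, 0), (0, 0, v)])
        (Icc 0 1 ×ˢ U) (t, y) (1, 0) -
      (Θ (1, t, y) ![(0, 1, 0), (0, 0, v)] - Θ (0, t, y) ![(0, 1, 0), (0, 0, v)]) := by
    intro t ht
    have hz : (t, y) ∈ Icc (0 : ℝ) 1 ×ˢ U := ⟨ht, hy⟩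
    rw [fderivWithin_integral_slice_apply hU2 hUc.Icc_prod (hsm _) hz,
      fderivWithin_integral_slice_apply hU2 hUc.Icc_prod (hsm _) hz,
      ← integral_fderivWithin_slice hU2 (hsm ![(0, 1, 0), (0, 0, v)]) hz,
      ← intervalIntegral.integral_sub (intervalIntegrable_fderivWithin_slice hU2 (hsm _) hz _)
        (intervalIntegrable_fderivWithin_slice hU2 (hsm _) hz _)]
    refine intervalIntegral.integral_congr fun u hu => ?_
    rw [uIcc_of_le zero_le_one] at hu
    have hz3 : (u, t, y) ∈ Icc (0 : ℝ) 1 ×ˢ Icc (0 : ℝ) 1 ×ˢ U := ⟨hu, hz⟩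
    have := cyclic_sum_eq_zero (hΘ.differentiableOn (by simp) _ hz3) (hU3 _ hz3) (hd _ hz3)
      (1, 0, 0) (0, 1, 0) (0, 0, v)
    simp only [Prod.mk_zero_zero] at this ⊢
    linarith
  rw [intervalIntegral.integral_congr fun t ht => hstep t (by
    rwa [uIcc_of_le zero_le_one] at ht)]
  have hslice : ∀ u ∈ Icc (0 : ℝ) 1, IntervalIntegrable
      (fun t => Θ (u, t, y) ![(0, 1, 0), (0, 0, v)]) volume 0 1 := fun u hu =>
    intervalIntegrable_slice (U := U)
      (F := fun z : ℝ × E => Θ (u, z) ![(0, 1, 0), (0, 0, v)])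
      ((hsm _).continuousOn.comp (by fun_prop) fun z hz => ⟨hu, hz⟩) hy
  have hi0 := hslice 0 (by simp)
  have hi1 := hslice 1 (by simp)
  rw [intervalIntegral.integral_sub (intervalIntegrable_fderivWithin_slice hU (hK _) hy _)
    (hi1.sub hi0), intervalIntegral.integral_sub hi1 hi0,
    integral_fderivWithin_slice hU (hK _) hy]
  -- Integrating `∂_t` leaves `∫ Θ(∂_u, v) du` at `t = 0` and `t = 1`, which `h0` and `h1` remove.
  have hz0 : ∫ u in (0 : ℝ)..1, Θ (u, 0, y) ![(1, 0, 0), (0, 0, v)] = 0 :=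
    (intervalIntegral.integral_congr (g := fun _ => 0) fun u hu => h0 u (by
      rwa [uIcc_of_le zero_le_one] at hu)).trans (by simp)
  have hz1 : ∫ u in (0 : ℝ)..1, Θ (u, 1, y) ![(1, 0, 0), (0, 0, v)] = 0 :=
    (intervalIntegral.integral_congr (g := fun _ => 0) fun u hu => h1 u (by
      rwa [uIcc_of_le zero_le_one] at hu)).trans (by simp)
  rw [hz0, hz1]
  ring

end SliceCalculus

/-! ### Flux forms at the two ends of a two-parameter family. -/

section Homotopy

variable {n : ℕ} [NeZero n]
  {X : Type*} [TopologicalSpace X] [ChartedSpace (EuclideanSpace ℝ (Fin (2 * n))) X]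
  {L : Type*} [TopologicalSpace L] [ChartedSpace (EuclideanHalfSpace n) L]

/-- A two-parameter family `h : [0, 1]² × L → X` read in the chart of `L` around `x₀`. -/
def chartFamily₂ (h : (unitInterval × unitInterval) × L → X) (x₀ : L)
    (z : ℝ × ℝ × EuclideanSpace ℝ (Fin n)) : X :=
  h ((projI z.1, projI z.2.1), (extChartAt (𝓡∂ n) x₀).symm z.2.2)

/-- The integral of `ωX` over the square swept out by the point `p`. -/
def areaFunction (ωX : DForm (𝓡 (2 * n)) X 2) (h : (unitInterval × unitInterval) × L → X)
    (p : L) : ℝ :=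
  ∫ t in (0 : ℝ)..1, ∫ u in (0 : ℝ)..1,
    pullbackOn ωX (fun z : ℝ × ℝ => h ((projI z.1, projI z.2), p)) (Icc 0 1 ×ˢ Icc 0 1) (u, t)
      ![(1, 0), (0, 1)]

/-- `areaFunction` as a differential form of degree zero. -/
def areaForm (ωX : DForm (𝓡 (2 * n)) X 2) (h : (unitInterval × unitInterval) × L → X) :
    DForm (𝓡∂ n) L 0 := fun p =>
  (ContinuousAlternatingMap.constOfIsEmpty ℝ (EuclideanSpace ℝ (Fin n)) (Fin 0)
    (areaFunction ωX h p) : EuclideanSpace ℝ (Fin n) [⋀^Fin 0]→L[ℝ] ℝ)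

theorem contMDiffOn_square {h : (unitInterval × unitInterval) × L → X}
    (hh : ContMDiff (((𝓡∂ 1).prod (𝓡∂ 1)).prod (𝓡∂ n)) (𝓡 (2 * n)) ∞ h) (p : L) :
    ContMDiffOn 𝓘(ℝ, ℝ × ℝ) (𝓡 (2 * n)) ∞ (fun z : ℝ × ℝ => h ((projI z.1, projI z.2), p))
      (Icc 0 1 ×ˢ Icc 0 1) := by
  have h1 : ContMDiffOn 𝓘(ℝ, ℝ × ℝ) (𝓡∂ 1) ∞ (fun z : ℝ × ℝ => projI z.1) (Icc 0 1 ×ˢ Icc 0 1) :=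
    contMDiffOn_projIcc.comp contDiff_fst.contMDiff.contMDiffOn fun z hz => hz.1
  have h2 : ContMDiffOn 𝓘(ℝ, ℝ × ℝ) (𝓡∂ 1) ∞ (fun z : ℝ × ℝ => projI z.2) (Icc 0 1 ×ˢ Icc 0 1) :=
    contMDiffOn_projIcc.comp contDiff_snd.contMDiff.contMDiffOn fun z hz => hz.2
  exact hh.comp_contMDiffOn ((h1.prodMk h2).prodMk contMDiffOn_const)

theorem contMDiff_homotopy_slice {h : (unitInterval × unitInterval) × L → X}
    (hh : ContMDiff (((𝓡∂ 1).prod (𝓡∂ 1)).prod (𝓡∂ n)) (𝓡 (2 * n)) ∞ h) (u : unitInterval) :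
    ContMDiff ((𝓡∂ 1).prod (𝓡∂ n)) (𝓡 (2 * n)) ∞
      (fun z : unitInterval × L => h ((u, z.1), z.2)) :=
  hh.comp ((contMDiff_const.prodMk contMDiff_fst).prodMk contMDiff_snd)

/-- For `p` in `C i` the whole square `h (·, ·, p)` lies in the isotropic submanifold `Λ i`, so it
has zero area. -/
theorem vanishesOnBoundary_areaForm {h : (unitInterval × unitInterval) × L → X}
    {ωX : DForm (𝓡 (2 * n)) X 2} {d : ℕ} {C : Fin d → Set L} (hC : IsBoundaryEnumeration n C)
    {Λ : Fin d → Set X} (hΛ : ∀ i, IsLagrangianSubmanifold ωX (Λ i))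
    (hh : ContMDiff (((𝓡∂ 1).prod (𝓡∂ 1)).prod (𝓡∂ n)) (𝓡 (2 * n)) ∞ h)
    (hb : ∀ y i, ∀ p ∈ C i, h (y, p) ∈ Λ i) : VanishesOnBoundary (areaForm ωX h) := by
  intro p hp v _
  obtain ⟨i, hi⟩ := hC.exists_eq hp
  have hpC : p ∈ C i := hi ▸ mem_connectedComponentIn hp
  change areaFunction ωX h p = 0
  refine (intervalIntegral.integral_congr (g := fun _ => 0) fun t ht => ?_).trans (by simp)
  refine (intervalIntegral.integral_congr (g := fun _ => 0) fun u hu => ?_).trans (by simp)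
  rw [uIcc_of_le zero_le_one] at ht hu
  have hz : (u, t) ∈ Icc (0 : ℝ) 1 ×ˢ Icc (0 : ℝ) 1 := ⟨hu, ht⟩
  have htan := fun w => mfderivWithin_mem_tangentOf (hΛ i) hz
    (uniqueDiffOn_Icc_prod (uniqueDiffOn_Icc zero_lt_one) _ hz)
    ((contMDiffOn_square hh p _ hz).mdifferentiableWithinAt (by simp))
    (fun z _ => hb _ i p hpC) w
  have := (hΛ i).isotropic _ (hb (projI u, projI t) i p hpC) _ (htan (1, 0)) _ (htan (0, 1))
  refine Eq.trans (DForm.apply_congr ωX rfl (funext fun j => ?_)) this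
  fin_cases j <;> rfl

variable [IsManifold (𝓡∂ n) ∞ L]

theorem contMDiffOn_chartFamily₂ {h : (unitInterval × unitInterval) × L → X}
    (hh : ContMDiff (((𝓡∂ 1).prod (𝓡∂ 1)).prod (𝓡∂ n)) (𝓡 (2 * n)) ∞ h) (x₀ : L) :
    ContMDiffOn 𝓘(ℝ, ℝ × ℝ × EuclideanSpace ℝ (Fin n)) (𝓡 (2 * n)) ∞ (chartFamily₂ h x₀)
      (Icc 0 1 ×ˢ chartDomain n x₀) := by
  have h1 : ContMDiffOn 𝓘(ℝ, ℝ × ℝ × EuclideanSpace ℝ (Fin n)) (𝓡∂ 1) ∞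
      (fun z : ℝ × ℝ × EuclideanSpace ℝ (Fin n) => projI z.1) (Icc 0 1 ×ˢ chartDomain n x₀) :=
    contMDiffOn_projIcc.comp contDiff_fst.contMDiff.contMDiffOn fun z hz => hz.1
  have h2 : ContMDiffOn 𝓘(ℝ, ℝ × ℝ × EuclideanSpace ℝ (Fin n)) (𝓡∂ 1) ∞
      (fun z : ℝ × ℝ × EuclideanSpace ℝ (Fin n) => projI z.2.1) (Icc 0 1 ×ˢ chartDomain n x₀) :=
    contMDiffOn_projIcc.comp (contDiff_fst.comp contDiff_snd).contMDiff.contMDiffOn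
      fun z hz => hz.2.1
  have h3 : ContMDiffOn 𝓘(ℝ, ℝ × ℝ × EuclideanSpace ℝ (Fin n)) (𝓡∂ n) ∞
      (fun z : ℝ × ℝ × EuclideanSpace ℝ (Fin n) => (extChartAt (𝓡∂ n) x₀).symm z.2.2)
      (Icc 0 1 ×ˢ chartDomain n x₀) :=
    (contMDiffOn_extChartAt_symm x₀).comp (contDiff_snd.comp contDiff_snd).contMDiff.contMDiffOn
      fun z hz => hz.2.2
  exact hh.comp_contMDiffOn ((h1.prodMk h2).prodMk h3)

variable {h : (unitInterval × unitInterval) × L → X} {x₀ : L} {ωX : DForm (𝓡 (2 * n)) X 2}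

/-- The area is defined at each point without a chart of `L`; this identifies its integrand with a
component of one smooth form on the chart domain, which can be differentiated in `y`. -/
theorem pullback_square_eq (hh : ContMDiff (((𝓡∂ 1).prod (𝓡∂ 1)).prod (𝓡∂ n)) (𝓡 (2 * n)) ∞ h)
    {u t : ℝ} (hu : u ∈ Icc (0 : ℝ) 1) (ht : t ∈ Icc (0 : ℝ) 1) {y : EuclideanSpace ℝ (Fin n)}
    (hy : y ∈ (extChartAt (𝓡∂ n) x₀).target) :
    pullbackOn ωX (fun z : ℝ × ℝ => h ((projI z.1, projI z.2), (extChartAt (𝓡∂ n) x₀).symm y))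
      (Icc 0 1 ×ˢ Icc 0 1) (u, t) ![(1, 0), (0, 1)] =
    pullbackOn ωX (chartFamily₂ h x₀) (Icc 0 1 ×ˢ chartDomain n x₀) (u, t, y)
      ![(1, 0, 0), (0, 1, 0)] := by
  have hj : HasFDerivWithinAt (fun z : ℝ × ℝ => (z.1, z.2, y))
      ((ContinuousLinearMap.fst ℝ ℝ ℝ).prod ((ContinuousLinearMap.snd ℝ ℝ ℝ).prod
        (0 : ℝ × ℝ →L[ℝ] EuclideanSpace ℝ (Fin n)))) (Icc 0 1 ×ˢ Icc 0 1) (u, t) :=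
    (hasFDerivAt_fst.prodMk (hasFDerivAt_snd.prodMk (hasFDerivAt_const y _))).hasFDerivWithinAt
  have hc := pullbackOn_comp (η := ωX) (z' := (u, t)) (S := Icc 0 1 ×ˢ chartDomain n x₀)
    (g := chartFamily₂ h x₀) (j := fun z : ℝ × ℝ => (z.1, z.2, y))
    ((contMDiffOn_chartFamily₂ hh x₀ (u, t, y) ⟨hu, ht, hy⟩).mdifferentiableWithinAt (by simp))
    hj (uniqueDiffOn_Icc_prod (uniqueDiffOn_Icc zero_lt_one) (u, t) ⟨hu, ht⟩)
    (fun z hz => ⟨hz.1, hz.2, hy⟩)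
  refine (DFunLike.congr_fun hc ![(1, 0), (0, 1)]).trans ?_
  refine congrArg (pullbackOn ωX (chartFamily₂ h x₀) (Icc 0 1 ×ˢ chartDomain n x₀) (u, t, y)) ?_
  funext i
  fin_cases i <;> simp

theorem pullback_chartFamily₂_slice
    (hh : ContMDiff (((𝓡∂ 1).prod (𝓡∂ 1)).prod (𝓡∂ n)) (𝓡 (2 * n)) ∞ h)
    (u : unitInterval) {z : ℝ × EuclideanSpace ℝ (Fin n)} (hz : z ∈ chartDomain n x₀)
    (v : EuclideanSpace ℝ (Fin n)) :
    pullbackOn ωX (chartFamily₂ h x₀) (Icc 0 1 ×ˢ chartDomain n x₀) ((u : ℝ), z)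
      ![(0, 1, 0), (0, 0, v)] =
    pullbackOn ωX (chartFamily (fun q : unitInterval × L => h ((u, q.1), q.2)) x₀)
      (chartDomain n x₀) z ![(1, 0), (0, v)] := by
  have hc := pullbackOn_comp (η := ωX) (z' := z) (S := Icc 0 1 ×ˢ chartDomain n x₀)
    (g := chartFamily₂ h x₀) (j := fun z => ((u : ℝ), z)) (S' := chartDomain n x₀)
    ((contMDiffOn_chartFamily₂ hh x₀ ((u : ℝ), z) ⟨u.2, hz⟩).mdifferentiableWithinAt (by simp))
    (hasFDerivAt_prodMk_right (u : ℝ) z).hasFDerivWithinAt (uniqueDiffOn_chartDomain x₀ z hz)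
    (fun z hz => ⟨u.2, hz⟩)
  have he : chartFamily₂ (n := n) h x₀ ∘ (fun z => ((u : ℝ), z)) =
      chartFamily (fun q : unitInterval × L => h ((u, q.1), q.2)) x₀ := by
    funext z
    simp only [chartFamily₂, chartFamily, Function.comp_apply, projI_coe]
  rw [he] at hc
  rw [hc]
  refine congrArg (pullbackOn ωX (chartFamily₂ h x₀) (Icc 0 1 ×ˢ chartDomain n x₀) ((u : ℝ), z)) ?_
  funext i
  fin_cases i <;> simp

/-- If the end points `h (·, t₀, ·)` of a homotopy are reparametrizations of a fixed Lagrangian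
immersion, then they do not contribute to the homotopy formula. -/
theorem pullback_chartFamily₂_end
    (hh : ContMDiff (((𝓡∂ 1).prod (𝓡∂ 1)).prod (𝓡∂ n)) (𝓡 (2 * n)) ∞ h) (t : unitInterval)
    {f : L → X} (hf : ContMDiff (𝓡∂ n) (𝓡 (2 * n)) ∞ f)
    (hlag : ∀ p, (ωX (f p)).compContinuousLinearMap (mfderiv (𝓡∂ n) (𝓡 (2 * n)) f p) = 0)
    {γ : unitInterval × L → L} (hγ : ContMDiff ((𝓡∂ 1).prod (𝓡∂ n)) (𝓡∂ n) ∞ γ)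
    (hfγ : ∀ u p, h ((u, t), p) = f (γ (u, p)))
    {u : ℝ} (hu : u ∈ Icc (0 : ℝ) 1) {y : EuclideanSpace ℝ (Fin n)}
    (hy : y ∈ (extChartAt (𝓡∂ n) x₀).target) (v : EuclideanSpace ℝ (Fin n)) :
    pullbackOn ωX (chartFamily₂ h x₀) (Icc 0 1 ×ˢ chartDomain n x₀) (u, (t : ℝ), y)
      ![(1, 0, 0), (0, 0, v)] = 0 := by
  have hz : (u, y) ∈ chartDomain n x₀ := ⟨hu, hy⟩
  have hj : HasFDerivWithinAt (fun z : ℝ × EuclideanSpace ℝ (Fin n) => (z.1, (t : ℝ), z.2))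
      ((ContinuousLinearMap.fst ℝ ℝ (EuclideanSpace ℝ (Fin n))).prod
        ((0 : ℝ × EuclideanSpace ℝ (Fin n) →L[ℝ] ℝ).prod
        (ContinuousLinearMap.snd ℝ ℝ (EuclideanSpace ℝ (Fin n))))) (chartDomain n x₀) (u, y) :=
    (hasFDerivAt_fst.prodMk ((hasFDerivAt_const (t : ℝ) _).prodMk
      hasFDerivAt_snd)).hasFDerivWithinAt
  have hc := pullbackOn_comp (η := ωX) (z' := (u, y)) (S := Icc 0 1 ×ˢ chartDomain n x₀)
    (g := chartFamily₂ h x₀) (j := fun z : ℝ × EuclideanSpace ℝ (Fin n) => (z.1, (t : ℝ), z.2))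
    ((contMDiffOn_chartFamily₂ hh x₀ (u, (t : ℝ), y) ⟨hu, t.2, hy⟩).mdifferentiableWithinAt
      (by simp)) hj (uniqueDiffOn_chartDomain x₀ (u, y) hz) (fun z hz => ⟨hz.1, t.2, hz.2⟩)
  let Γ : ℝ × EuclideanSpace ℝ (Fin n) → L := fun z =>
    γ (projI z.1, (extChartAt (𝓡∂ n) x₀).symm z.2)
  have hΓ : ContMDiffOn 𝓘(ℝ, ℝ × EuclideanSpace ℝ (Fin n)) (𝓡∂ n) ∞ Γ (chartDomain n x₀) :=
    hγ.comp_contMDiffOn (contMDiffOn_chartParam x₀)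
  -- At time `t` the family factors through the `n`-manifold `L`, followed by the Lagrangian
  -- immersion `f`.
  have he : chartFamily₂ h x₀ ∘ (fun z : ℝ × EuclideanSpace ℝ (Fin n) => (z.1, (t : ℝ), z.2)) =
      f ∘ Γ := by
    funext z
    simp only [chartFamily₂, Function.comp_apply, projI_coe, hfγ, Γ]
  rw [he, pullbackOn_comp_eq_zero ((hf _).mdifferentiableAt (by simp))
    ((hΓ _ hz).mdifferentiableWithinAt (by simp)) (uniqueDiffOn_chartDomain x₀ (u, y) hz)
    (hlag _)] at hc
  refine Eq.trans ?_ (DFunLike.congr_fun hc ![(1, 0), (0, v)]).symm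
  refine congrArg (pullbackOn ωX (chartFamily₂ h x₀) (Icc 0 1 ×ˢ chartDomain n x₀)
    (u, (t : ℝ), y)) ?_
  funext i
  fin_cases i <;> simp

theorem areaFunction_chart (hh : ContMDiff (((𝓡∂ 1).prod (𝓡∂ 1)).prod (𝓡∂ n)) (𝓡 (2 * n)) ∞ h)
    {y : EuclideanSpace ℝ (Fin n)} (hy : y ∈ (extChartAt (𝓡∂ n) x₀).target) :
    areaFunction ωX h ((extChartAt (𝓡∂ n) x₀).symm y) =
      ∫ t in (0 : ℝ)..1, ∫ u in (0 : ℝ)..1, pullbackOn ωX (chartFamily₂ h x₀)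
        (Icc 0 1 ×ˢ chartDomain n x₀) (u, t, y) ![(1, 0, 0), (0, 1, 0)] := by
  refine intervalIntegral.integral_congr fun t ht => intervalIntegral.integral_congr fun u hu => ?_
  rw [uIcc_of_le zero_le_one] at ht hu
  exact pullback_square_eq hh hu ht hy

variable [IsManifold (𝓡 (2 * n)) ∞ X]

theorem contDiffOn_pullback_chartFamily₂ (hω : IsSmoothForm ωX)
    (hh : ContMDiff (((𝓡∂ 1).prod (𝓡∂ 1)).prod (𝓡∂ n)) (𝓡 (2 * n)) ∞ h) (x₀ : L) :
    ContDiffOn ℝ ∞ (pullbackOn ωX (chartFamily₂ h x₀) (Icc 0 1 ×ˢ chartDomain n x₀))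
      (Icc 0 1 ×ˢ chartDomain n x₀) :=
  contDiffOn_pullbackOn hω (uniqueDiffOn_Icc_prod (uniqueDiffOn_chartDomain x₀))
    (contMDiffOn_chartFamily₂ hh x₀)

theorem isSmoothForm_areaForm (hω : IsSmoothForm ωX)
    (hh : ContMDiff (((𝓡∂ 1).prod (𝓡∂ 1)).prod (𝓡∂ n)) (𝓡 (2 * n)) ∞ h) :
    IsSmoothForm (areaForm ωX h) := by
  intro x₀
  have hT := uniqueDiffOn_extChartAt_target (I := 𝓡∂ n) x₀
  have hTc := locallyConvexSet_extChartAt_target (𝓡∂ n) x₀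
  refine contDiffOn_alternating_of_apply fun v => ?_
  refine ContDiffOn.congr ?_ fun y hy => areaFunction_chart hh hy
  refine contDiffOn_integral_slice hT hTc (F := fun z => ∫ u in (0 : ℝ)..1, pullbackOn ωX
    (chartFamily₂ h x₀) (Icc 0 1 ×ˢ chartDomain n x₀) (u, z) ![(1, 0, 0), (0, 1, 0)]) ?_
  exact contDiffOn_integral_slice (uniqueDiffOn_chartDomain x₀) hTc.Icc_prod
    (F := fun z => pullbackOn ωX (chartFamily₂ h x₀) (Icc 0 1 ×ˢ chartDomain n x₀) z
      ![(1, 0, 0), (0, 1, 0)])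
    ((ContinuousAlternatingMap.apply ℝ (ℝ × ℝ × EuclideanSpace ℝ (Fin n)) ℝ
      ![(1, 0, 0), (0, 1, 0)]).contDiff.comp_contDiffOn (contDiffOn_pullback_chartFamily₂ hω hh x₀))

/-- The fluxes at the two ends of a homotopy differ by an exact form, provided that `h (·, 0, ·)` and
`h (·, 1, ·)` are reparametrizations of fixed Lagrangian immersions. -/
theorem fluxForm_sub_mem_relExact (hω : IsSmoothForm ωX) (hdω : extD ωX = 0)
    {d : ℕ} {C : Fin d → Set L} (hC : IsBoundaryEnumeration n C)
    {Λ : Fin d → Set X} (hΛ : ∀ i, IsLagrangianSubmanifold ωX (Λ i))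
    (hh : ContMDiff (((𝓡∂ 1).prod (𝓡∂ 1)).prod (𝓡∂ n)) (𝓡 (2 * n)) ∞ h)
    (hb : ∀ y i, ∀ p ∈ C i, h (y, p) ∈ Λ i)
    (hends : ∀ t : unitInterval, t = 0 ∨ t = 1 → ∃ (f : L → X) (γ : unitInterval × L → L),
      ContMDiff (𝓡∂ n) (𝓡 (2 * n)) ∞ f ∧
      (∀ p, (ωX (f p)).compContinuousLinearMap (mfderiv (𝓡∂ n) (𝓡 (2 * n)) f p) = 0) ∧
      ContMDiff ((𝓡∂ 1).prod (𝓡∂ n)) (𝓡∂ n) ∞ γ ∧ ∀ u p, h ((u, t), p) = f (γ (u, p))) :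
    fluxForm ωX (fun q : unitInterval × L => h ((0, q.1), q.2)) -
      fluxForm ωX (fun q : unitInterval × L => h ((1, q.1), q.2)) ∈ relExact n L 0 := by
  -- The primitive is the area swept out by each point. The order of the arguments `∂_u, ∂_t` gives
  -- the difference the sign of the statement.
  refine ⟨areaForm ωX h, ⟨isSmoothForm_areaForm hω hh, vanishesOnBoundary_areaForm hC hΛ hh hb⟩, ?_⟩
  funext p
  set φ := extChartAt (𝓡∂ n) p with hφ
  have hT := uniqueDiffOn_extChartAt_target (I := 𝓡∂ n) p
  have hTc := locallyConvexSet_extChartAt_target (𝓡∂ n) p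
  have hpT : φ p ∈ φ.target := mem_extChartAt_target p
  have hend : ∀ t : unitInterval, t = 0 ∨ t = 1 → ∀ v, ∀ u ∈ Icc (0 : ℝ) 1,
      pullbackOn ωX (chartFamily₂ h p) (Icc 0 1 ×ˢ chartDomain n p) (u, (t : ℝ), φ p)
        ![(1, 0, 0), (0, 0, v)] = 0 := by
    intro t ht v u hu
    obtain ⟨f, γ, hf, hlag, hγ, hfγ⟩ := hends t ht
    exact pullback_chartFamily₂_end hh t hf hlag hγ hfγ hu hpT v
  have hflux : ∀ (u : unitInterval) (v : Fin 1 → EuclideanSpace ℝ (Fin n)),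
      (show EuclideanSpace ℝ (Fin n) [⋀^Fin 1]→L[ℝ] ℝ from
        fluxForm ωX (fun q : unitInterval × L => h ((u, q.1), q.2)) p) v =
      ∫ t in (0 : ℝ)..1, pullbackOn ωX (chartFamily₂ h p) (Icc 0 1 ×ˢ chartDomain n p)
        ((u : ℝ), t, φ p) ![(0, 1, 0),
          (0, 0, mfderiv (𝓡∂ n) 𝓘(ℝ, EuclideanSpace ℝ (Fin n)) φ p (v 0))] := by
    intro u v
    rw [fluxForm_apply hω (contMDiff_homotopy_slice hh u)]
    refine intervalIntegral.integral_congr fun t ht => ?_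
    rw [uIcc_of_le zero_le_one] at ht
    have hz : (t, φ p) ∈ chartDomain n p := ⟨ht, hpT⟩
    exact (fluxIntegrand_apply ωX (contMDiff_homotopy_slice hh u) p ht v).trans
      (pullback_chartFamily₂_slice hh u hz _).symm
  have hderiv : ∀ v, fderivWithin ℝ (fun y => areaFunction ωX h (φ.symm y)) (range (𝓡∂ n)) (φ p) v =
      (∫ t in (0 : ℝ)..1, pullbackOn ωX (chartFamily₂ h p) (Icc 0 1 ×ˢ chartDomain n p)
        (0, t, φ p) ![(0, 1, 0), (0, 0, v)]) -
      ∫ t in (0 : ℝ)..1, pullbackOn ωX (chartFamily₂ h p) (Icc 0 1 ×ˢ chartDomain n p)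
        (1, t, φ p) ![(0, 1, 0), (0, 0, v)] := by
    intro v
    rw [← fderivWithin_double_integral hT hTc (contDiffOn_pullback_chartFamily₂ hω hh p)
      (fun z hz => ?_) hpT v (fun u hu => ?_) (fun u hu => ?_)]
    -- `extD` differentiates within `range (𝓡∂ n)` and the homotopy formula within the chart target;
    -- the two sets have the same germ at `φ p`.
    · rw [← fderivWithin_congr (fun y hy => areaFunction_chart hh hy) (areaFunction_chart hh hpT)]
      exact DFunLike.congr_fun (fderivWithin_congr_set (nhdsWithin_eq_iff_eventuallyEq.1
        (nhdsWithin_extChartAt_target_eq p).symm)) v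
    · rw [extDerivWithin_pullbackOn hω (uniqueDiffOn_Icc_prod (uniqueDiffOn_chartDomain p))
        (Icc_prod_subset_closure_interior (Icc_prod_subset_closure_interior
          extChartAt_target_subset_closure_interior)) (contMDiffOn_chartFamily₂ hh p) hz, hdω]
      rfl
    · exact hend 0 (Or.inl rfl) v u hu
    · exact hend 1 (Or.inr rfl) v u hu
  have hext : extDerivWithin (chartRep (areaForm ωX h) p) (range (𝓡∂ n)) (φ p) =
      .ofSubsingleton _ _ _ (0 : Fin 1)
        (fderivWithin ℝ (fun y => areaFunction ωX h (φ.symm y)) (range (𝓡∂ n)) (φ p)) :=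
    extDerivWithin_constOfIsEmpty (fun y => areaFunction ωX h (φ.symm y))
      ((𝓡∂ n).uniqueDiffOn _ (extChartAt_target_subset_range p hpT))
  ext v
  have h1 : (show EuclideanSpace ℝ (Fin n) [⋀^Fin 1]→L[ℝ] ℝ from extD (areaForm ωX h) p) v =
      extDerivWithin (chartRep (areaForm ωX h) p) (range (𝓡∂ n)) (φ p)
        (fun i => mfderiv (𝓡∂ n) 𝓘(ℝ, EuclideanSpace ℝ (Fin n)) φ p (v i)) := rfl
  refine h1.trans ?_
  rw [hext]
  refine (hderiv _).trans ?_
  exact congrArg₂ (· - ·) (hflux 0 v).symm (hflux 1 v).symm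

end Homotopy

/-! ### Smooth families of immersions in charts. -/

section ImmersionCharts

variable {n : ℕ} [NeZero n]
  {X : Type*} [TopologicalSpace X] [ChartedSpace (EuclideanSpace ℝ (Fin (2 * n))) X]
  [IsManifold (𝓡 (2 * n)) ∞ X]
  {L : Type*} [TopologicalSpace L] [ChartedSpace (EuclideanHalfSpace n) L]
  [IsManifold (𝓡∂ n) ∞ L]

/-- The coordinate expression of `(t, q) ↦ (t, f (t, q))` in the chart of `L` around `q₀` and the
chart of `X` around `x₀`. -/
def chartGraph (f : unitInterval × L → X) (q₀ : L) (x₀ : X) (z : ℝ × EuclideanSpace ℝ (Fin n)) :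
    ℝ × EuclideanSpace ℝ (Fin (2 * n)) :=
  (z.1, extChartAt (𝓡 (2 * n)) x₀ (chartFamily f q₀ z))

variable {f : unitInterval × L → X}

theorem contDiffOn_chartGraph (hf : ContMDiff ((𝓡∂ 1).prod (𝓡∂ n)) (𝓡 (2 * n)) ∞ f) (q₀ : L)
    (x₀ : X) {S : Set (ℝ × EuclideanSpace ℝ (Fin n))} (hS : S ⊆ chartDomain n q₀)
    (hsrc : ∀ z ∈ S, chartFamily f q₀ z ∈ (extChartAt (𝓡 (2 * n)) x₀).source) :
    ContDiffOn ℝ ∞ (chartGraph f q₀ x₀) S := by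
  refine contDiff_fst.contDiffOn.prodMk ?_
  rw [← contMDiffOn_iff_contDiffOn]
  exact contMDiffOn_extChartAt.comp ((contMDiffOn_chartFamily hf q₀).mono hS)
    fun z hz => by
      rw [mem_preimage, ← extChartAt_source (𝓡 (2 * n))]
      exact hsrc z hz

/-- Recording `t` as a coordinate turns a family of immersions into a single immersion: the first
component of a kernel vector vanishes, and the rest is killed by the derivative of `f_t`, which is
injective. -/
theorem injective_fderivWithin_chartGraph
    (hf : ContMDiff ((𝓡∂ 1).prod (𝓡∂ n)) (𝓡 (2 * n)) ∞ f)
    (himm : ∀ t p, Function.Injective (mfderiv (𝓡∂ n) (𝓡 (2 * n)) (fun q => f (t, q)) p))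
    {q₀ : L} {x₀ : X} {z : ℝ × EuclideanSpace ℝ (Fin n)} (hz : z ∈ chartDomain n q₀)
    (hsrc : chartFamily f q₀ z ∈ (extChartAt (𝓡 (2 * n)) x₀).source) :
    Function.Injective (fderivWithin ℝ (chartGraph f q₀ x₀) (chartDomain n q₀) z) := by
  have hu := uniqueDiffOn_chartDomain (n := n) q₀ z hz
  have hg : MDifferentiableWithinAt 𝓘(ℝ, ℝ × EuclideanSpace ℝ (Fin n)) (𝓡 (2 * n))
      (chartFamily f q₀) (chartDomain n q₀) z :=
    (contMDiffOn_chartFamily hf q₀ z hz).mdifferentiableWithinAt (by simp)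
  have hψ : MDifferentiableAt (𝓡 (2 * n)) 𝓘(ℝ, EuclideanSpace ℝ (Fin (2 * n)))
      (extChartAt (𝓡 (2 * n)) x₀) (chartFamily f q₀ z) :=
    (contMDiffAt_extChartAt' (n := ∞)
      (by simpa only [extChartAt_source] using hsrc)).mdifferentiableAt (by simp)
  have hd : DifferentiableWithinAt ℝ (extChartAt (𝓡 (2 * n)) x₀ ∘ chartFamily f q₀)
      (chartDomain n q₀) z :=
    (hψ.comp_mdifferentiableWithinAt z hg).differentiableWithinAt
  have hF : fderivWithin ℝ (chartGraph f q₀ x₀) (chartDomain n q₀) z =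
      (ContinuousLinearMap.fst ℝ ℝ (EuclideanSpace ℝ (Fin n))).prod
        (fderivWithin ℝ (extChartAt (𝓡 (2 * n)) x₀ ∘ chartFamily f q₀) (chartDomain n q₀) z) :=
    (hasFDerivAt_fst.hasFDerivWithinAt.prodMk hd.hasFDerivWithinAt).fderivWithin hu
  rw [hF, injective_iff_map_eq_zero]
  rintro ⟨τ, v⟩ h
  obtain ⟨h1, h2⟩ := Prod.mk.inj h
  change τ = 0 at h1
  subst h1
  have h3 := mfderiv_slice_eq_mfderivWithin hf hz v
  rw [mfderivWithin_eq_extChartAt hsrc hg hu] at h3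
  have h4 : fderivWithin ℝ (extChartAt (𝓡 (2 * n)) x₀ ∘ chartFamily f q₀) (chartDomain n q₀) z
    (0, v) = 0 := h2
  rw [h4] at h3
  have h5 := himm _ _ ((h3.trans (map_zero _)).trans (map_zero _).symm)
  have h6 := (isInvertible_mfderivWithin_extChartAt_symm (I := 𝓡∂ n) hz.2).injective
    (h5.trans (map_zero _).symm)
  rw [Prod.mk_eq_zero]
  exact ⟨rfl, h6⟩

/-- Quantitative injectivity of a family of immersions in suitable charts. -/
theorem exists_chartGraph_perturbation_id
    (hf : ContMDiff ((𝓡∂ 1).prod (𝓡∂ n)) (𝓡 (2 * n)) ∞ f)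
    (himm : ∀ t p, Function.Injective (mfderiv (𝓡∂ n) (𝓡 (2 * n)) (fun q => f (t, q)) p))
    (t₀ : unitInterval) (q₀ : L) :
    ∃ (P : ℝ × EuclideanSpace ℝ (Fin (2 * n)) →L[ℝ] ℝ × EuclideanSpace ℝ (Fin n)) (r r' : ℝ),
      0 < r ∧ r ≤ r' ∧
      (∀ z ∈ chartDomain n q₀ ∩ Metric.ball ((t₀ : ℝ), extChartAt (𝓡∂ n) q₀ q₀) r',
        chartFamily f q₀ z ∈ (extChartAt (𝓡 (2 * n)) (f (t₀, q₀))).source) ∧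
      (∀ w ∈ chartDomain n q₀ ∩ Metric.ball ((t₀ : ℝ), extChartAt (𝓡∂ n) q₀ q₀) r,
        ‖P.comp (fderivWithin ℝ (chartGraph f q₀ (f (t₀, q₀)))
          (chartDomain n q₀ ∩ Metric.ball ((t₀ : ℝ), extChartAt (𝓡∂ n) q₀ q₀) r') w) -
          ContinuousLinearMap.id ℝ _‖ ≤ 1 / 2) ∧
      ∀ w ∈ chartDomain n q₀ ∩ Metric.ball ((t₀ : ℝ), extChartAt (𝓡∂ n) q₀ q₀) r,
        ∀ w' ∈ chartDomain n q₀ ∩ Metric.ball ((t₀ : ℝ), extChartAt (𝓡∂ n) q₀ q₀) r,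
        ‖w - w'‖ ≤ 2 * ‖P (chartGraph f q₀ (f (t₀, q₀)) w) - P (chartGraph f q₀ (f (t₀, q₀)) w')‖ := by
  set z₀ : ℝ × EuclideanSpace ℝ (Fin n) := ((t₀ : ℝ), extChartAt (𝓡∂ n) q₀ q₀) with hz₀def
  have hz₀ : z₀ ∈ chartDomain n q₀ := ⟨t₀.2, mem_extChartAt_target q₀⟩
  have hval : chartFamily f q₀ z₀ = f (t₀, q₀) := by
    simp only [chartFamily, z₀, projI_coe, extChartAt_to_inv]
  have hn : chartFamily f q₀ ⁻¹' (extChartAt (𝓡 (2 * n)) (f (t₀, q₀))).source ∈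
      𝓝[chartDomain n q₀] z₀ := by
    refine (contMDiffOn_chartFamily hf q₀).continuousOn z₀ hz₀ ?_
    rw [hval]
    exact extChartAt_source_mem_nhds (I := 𝓡 (2 * n)) _
  obtain ⟨ρ, hρ, hρsub⟩ := Metric.mem_nhdsWithin_iff.1 hn
  obtain ⟨ρ', hρ', hconv⟩ :=
    (locallyConvexSet_extChartAt_target (𝓡∂ n) q₀).Icc_prod z₀ hz₀
  set r' := min ρ ρ' with hr'
  have hr'pos : 0 < r' := lt_min hρ hρ'
  have hsrc : ∀ z ∈ chartDomain n q₀ ∩ Metric.ball z₀ r',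
      chartFamily f q₀ z ∈ (extChartAt (𝓡 (2 * n)) (f (t₀, q₀))).source := fun z hz =>
    hρsub ⟨Metric.ball_subset_ball (min_le_left _ _) hz.2, hz.1⟩
  have hconv' : Convex ℝ (chartDomain n q₀ ∩ Metric.ball z₀ r') := by
    have : chartDomain n q₀ ∩ Metric.ball z₀ r' =
        (chartDomain n q₀ ∩ Metric.ball z₀ ρ') ∩ Metric.ball z₀ r' := by
      rw [inter_assoc, inter_eq_self_of_subset_right
        (Metric.ball_subset_ball (min_le_right ρ ρ'))]
    rw [this]
    exact hconv.inter (convex_ball _ _)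
  have hz₀' : z₀ ∈ chartDomain n q₀ ∩ Metric.ball z₀ r' := ⟨hz₀, Metric.mem_ball_self hr'pos⟩
  have hinj := injective_fderivWithin_chartGraph hf himm hz₀ (hsrc z₀ hz₀')
  rw [← fderivWithin_inter (Metric.ball_mem_nhds z₀ hr'pos)] at hinj
  obtain ⟨P, r, hr, hb, hl⟩ := exists_linear_perturbation_id hconv'
    ((uniqueDiffOn_chartDomain q₀).inter Metric.isOpen_ball)
    (contDiffOn_chartGraph hf q₀ _ inter_subset_left hsrc) hz₀' hinj
  have hsub : ∀ w ∈ chartDomain n q₀ ∩ Metric.ball z₀ (min r r'),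
      w ∈ (chartDomain n q₀ ∩ Metric.ball z₀ r') ∩ Metric.ball z₀ r := fun w hw =>
    ⟨⟨hw.1, Metric.ball_subset_ball (min_le_right _ _) hw.2⟩,
      Metric.ball_subset_ball (min_le_left _ _) hw.2⟩
  exact ⟨P, min r r', r', lt_min hr hr'pos, min_le_right _ _, hsrc, fun w hw => hb w (hsub w hw),
    fun w hw w' hw' => hl w (hsub w hw) w' (hsub w' hw')⟩

/-- The members of a smooth family of immersions are locally injective. -/
theorem exists_nhds_injOn
    (hf : ContMDiff ((𝓡∂ 1).prod (𝓡∂ n)) (𝓡 (2 * n)) ∞ f)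
    (himm : ∀ t p, Function.Injective (mfderiv (𝓡∂ n) (𝓡 (2 * n)) (fun q => f (t, q)) p))
    (t₀ : unitInterval) (q₀ : L) :
    ∃ U ∈ 𝓝 q₀, InjOn (fun q => f (t₀, q)) U := by
  obtain ⟨P, r, r', hr, -, -, -, hl⟩ := exists_chartGraph_perturbation_id hf himm t₀ q₀
  have h1 : ∀ᶠ z in 𝓝 q₀,
      ((t₀ : ℝ), extChartAt (𝓡∂ n) q₀ z) ∈ Metric.ball ((t₀ : ℝ), extChartAt (𝓡∂ n) q₀ q₀) r :=
    (continuousAt_const.prodMk (continuousAt_extChartAt (I := 𝓡∂ n) q₀))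
      (Metric.ball_mem_nhds _ hr)
  have h2 : ∀ᶠ z in 𝓝 q₀, z ∈ (extChartAt (𝓡∂ n) q₀).source :=
    extChartAt_source_mem_nhds (I := 𝓡∂ n) q₀
  refine ⟨_, h1.and h2, fun q hq q' hq' h => ?_⟩
  have hF : ∀ q ∈ (extChartAt (𝓡∂ n) q₀).source,
      chartFamily f q₀ ((t₀ : ℝ), extChartAt (𝓡∂ n) q₀ q) = f (t₀, q) := fun q hq => by
    simp only [chartFamily, projI_coe, (extChartAt (𝓡∂ n) q₀).left_inv hq]
  -- Two points with equal images at the same time have equal coordinate graphs, so the lower bound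
  -- forces them to coincide.
  have := hl ((t₀ : ℝ), extChartAt (𝓡∂ n) q₀ q) ⟨⟨t₀.2, (extChartAt _ q₀).map_source hq.2⟩, hq.1⟩
    ((t₀ : ℝ), extChartAt (𝓡∂ n) q₀ q') ⟨⟨t₀.2, (extChartAt _ q₀).map_source hq'.2⟩, hq'.1⟩
  simp only [chartGraph, hF q hq.2, hF q' hq'.2] at this
  rw [show f (t₀, q) = f (t₀, q') from h] at this
  simp only [sub_self, norm_zero, mul_zero, norm_le_zero_iff, sub_eq_zero, Prod.mk.injEq,
    true_and] at this
  exact (extChartAt (𝓡∂ n) q₀).injOn hq.2 hq'.2 this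

/-- A continuous family of maps which become smooth after composition with a smooth family of
immersions is smooth. -/
theorem contMDiff_of_comp_immersion
    (hf : ContMDiff ((𝓡∂ 1).prod (𝓡∂ n)) (𝓡 (2 * n)) ∞ f)
    (himm : ∀ t p, Function.Injective (mfderiv (𝓡∂ n) (𝓡 (2 * n)) (fun q => f (t, q)) p))
    {g : unitInterval × L → X} (hg : ContMDiff ((𝓡∂ 1).prod (𝓡∂ n)) (𝓡 (2 * n)) ∞ g)
    {a : unitInterval × L → L} (ha : Continuous a) (hfg : ∀ t p, f (t, a (t, p)) = g (t, p)) :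
    ContMDiff ((𝓡∂ 1).prod (𝓡∂ n)) (𝓡∂ n) ∞ a := by
  rintro ⟨t₀, p₀⟩
  set q₀ := a (t₀, p₀) with hq₀
  obtain ⟨P, r, r', hr, hrr', hsrc, hb, hl⟩ := exists_chartGraph_perturbation_id hf himm t₀ q₀
  set w₀ : ℝ × EuclideanSpace ℝ (Fin n) := ((t₀ : ℝ), extChartAt (𝓡∂ n) q₀ q₀) with hw₀
  set z₀ : ℝ × EuclideanSpace ℝ (Fin n) := ((t₀ : ℝ), extChartAt (𝓡∂ n) p₀ p₀) with hz₀
  let A : ℝ × EuclideanSpace ℝ (Fin n) → L := fun z =>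
    a (projI z.1, (extChartAt (𝓡∂ n) p₀).symm z.2)
  -- `Φ` is `(t, p) ↦ (t, a (t, p))` in charts. It solves `chartGraph f ∘ Φ = chartGraph g`, and
  -- continuity of `a` keeps it in the small region where the quantitative estimates hold.
  let Φ : ℝ × EuclideanSpace ℝ (Fin n) → ℝ × EuclideanSpace ℝ (Fin n) := fun z =>
    (z.1, extChartAt (𝓡∂ n) q₀ (A z))
  have hz₀mem : z₀ ∈ chartDomain n p₀ := ⟨t₀.2, mem_extChartAt_target p₀⟩
  have hA : ContinuousOn A (chartDomain n p₀) :=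
    ha.comp_continuousOn (contMDiffOn_chartParam p₀).continuousOn
  have hAz₀ : A z₀ = q₀ := by
    simp only [A, z₀, projI_coe, extChartAt_to_inv, q₀]
  have hΦ : ContinuousWithinAt Φ (chartDomain n p₀) z₀ := by
    refine continuous_fst.continuousWithinAt.prodMk ?_
    exact ContinuousAt.comp_continuousWithinAt_of_eq (continuousAt_extChartAt q₀)
      (hA z₀ hz₀mem) hAz₀
  have hΦz₀ : Φ z₀ = w₀ := by simp only [Φ, hAz₀, z₀, w₀]
  have hn : A ⁻¹' (extChartAt (𝓡∂ n) q₀).source ∩ Φ ⁻¹' Metric.ball w₀ r ∈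
      𝓝[chartDomain n p₀] z₀ := by
    refine inter_mem (hA z₀ hz₀mem ?_) (hΦ ?_)
    · rw [hAz₀]
      exact extChartAt_source_mem_nhds (I := 𝓡∂ n) q₀
    · rw [hΦz₀]
      exact Metric.ball_mem_nhds _ hr
  obtain ⟨ρ, hρ, hsub⟩ := Metric.mem_nhdsWithin_iff.1 hn
  set S := chartDomain n p₀ ∩ Metric.ball z₀ ρ with hS
  have hSsrc : ∀ z ∈ S, A z ∈ (extChartAt (𝓡∂ n) q₀).source := fun z hz => (hsub ⟨hz.2, hz.1⟩).1
  have hmaps : MapsTo Φ S (chartDomain n q₀ ∩ Metric.ball w₀ r) := fun z hz =>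
    ⟨⟨hz.1.1, (extChartAt (𝓡∂ n) q₀).map_source (hSsrc z hz)⟩, (hsub ⟨hz.2, hz.1⟩).2⟩
  have hgf : ∀ z ∈ S, chartFamily g p₀ z = chartFamily f q₀ (Φ z) := fun z hz => by
    simp only [chartFamily, Φ, (extChartAt (𝓡∂ n) q₀).left_inv (hSsrc z hz)]
    exact (hfg _ _).symm
  have hball : chartDomain n q₀ ∩ Metric.ball w₀ r ⊆ chartDomain n q₀ ∩ Metric.ball w₀ r' :=
    inter_subset_inter_right _ (Metric.ball_subset_ball hrr')
  have hSu : UniqueDiffOn ℝ S := (uniqueDiffOn_chartDomain p₀).inter Metric.isOpen_ball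
  have hsm : ContDiffOn ℝ ∞ Φ S :=
    contDiffOn_of_comp_immersion hball
      ((uniqueDiffOn_chartDomain q₀).inter Metric.isOpen_ball)
      (contDiffOn_chartGraph hf q₀ _ inter_subset_left hsrc) hb hl hmaps hSu
      (K := chartGraph g p₀ (f (t₀, q₀)))
      (contDiffOn_chartGraph hg p₀ _ inter_subset_left fun z hz => by
        rw [hgf z hz]
        exact hsrc _ (hball (hmaps hz)))
      (fun z hz => by simp only [chartGraph, hgf z hz, Φ])
  have hz₀S : z₀ ∈ S := ⟨hz₀mem, Metric.mem_ball_self hρ⟩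
  let κ : unitInterval × L → ℝ × EuclideanSpace ℝ (Fin n) := fun z =>
    ((z.1 : ℝ), extChartAt (𝓡∂ n) p₀ z.2)
  have hκ : ContMDiffAt ((𝓡∂ 1).prod (𝓡∂ n)) 𝓘(ℝ, ℝ × EuclideanSpace ℝ (Fin n)) ∞ κ (t₀, p₀) := by
    rw [modelWithCornersSelf_prod, ← chartedSpaceSelf_prod]
    exact (contMDiff_subtypeVal_Icc.comp contMDiff_fst).contMDiffAt.prodMk
      (contMDiffAt_extChartAt.comp (t₀, p₀) contMDiffAt_snd)
  have hev : ∀ᶠ z in 𝓝 ((t₀, p₀) : unitInterval × L),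
      z.2 ∈ (extChartAt (𝓡∂ n) p₀).source ∧ κ z ∈ S := by
    have h1 : ∀ᶠ z in 𝓝 ((t₀, p₀) : unitInterval × L), z.2 ∈ (extChartAt (𝓡∂ n) p₀).source :=
      continuousAt_snd (extChartAt_source_mem_nhds (I := 𝓡∂ n) p₀)
    have h2 : ∀ᶠ z in 𝓝 ((t₀, p₀) : unitInterval × L), κ z ∈ Metric.ball z₀ ρ :=
      hκ.continuousAt (Metric.ball_mem_nhds _ hρ)
    filter_upwards [h1, h2] with z hz1 hz2
    exact ⟨hz1, ⟨z.1.2, (extChartAt (𝓡∂ n) p₀).map_source hz1⟩, hz2⟩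
  have hAκ : ∀ z : unitInterval × L, z.2 ∈ (extChartAt (𝓡∂ n) p₀).source → A (κ z) = a z := by
    intro z hz
    simp only [A, κ, projI_coe, (extChartAt (𝓡∂ n) p₀).left_inv hz]
  have hcomp : ContMDiffWithinAt 𝓘(ℝ, ℝ × EuclideanSpace ℝ (Fin n)) (𝓡∂ n) ∞
      (fun z => (extChartAt (𝓡∂ n) q₀).symm (Φ z).2) S z₀ := by
    have h1 : ContMDiffWithinAt 𝓘(ℝ, ℝ × EuclideanSpace ℝ (Fin n))
        𝓘(ℝ, EuclideanSpace ℝ (Fin n)) ∞ (fun z => (Φ z).2) S z₀ :=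
      (contDiff_snd.comp_contDiffOn hsm z₀ hz₀S).contMDiffWithinAt
    exact (contMDiffOn_extChartAt_symm q₀ _ (hmaps hz₀S).1.2).comp z₀ h1
      fun z hz => (hmaps hz).1.2
  have hfin : ContMDiffAt ((𝓡∂ 1).prod (𝓡∂ n)) (𝓡∂ n) ∞
      (fun z => (extChartAt (𝓡∂ n) q₀).symm (Φ (κ z)).2) (t₀, p₀) :=
    (hcomp.comp (s := κ ⁻¹' S) (t₀, p₀) hκ.contMDiffWithinAt (mapsTo_preimage κ S)).contMDiffAt
      (hev.mono fun z hz => hz.2)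
  refine hfin.congr_of_eventuallyEq ?_
  filter_upwards [hev] with z hz
  simp only [Φ, hAκ z hz.1]
  have := hSsrc _ hz.2
  rw [hAκ z hz.1] at this
  exact ((extChartAt (𝓡∂ n) q₀).left_inv this).symm

end ImmersionCharts

/-! ### Limits of solutions of `f (s, a s p) = g (s, p)`. -/

section LocallyInjective

variable {T L X : Type*} [TopologicalSpace T] [TopologicalSpace L] [TopologicalSpace X]
  [T2Space X] [T2Space L] [CompactSpace L] [LocallyConnectedSpace L] {f g : T × L → X}
  {a : T → L → L} {t : T}

/-- If `f (s, a s p) = g (s, p)` where `f (t, ·)` is locally injective, then pointwise convergence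
of `a s` as `s → t` is locally uniform. -/
theorem tendsto_prod_of_tendsto_apply (hf : Continuous f) (hg : Continuous g)
    (ha : ∀ s, Continuous (a s)) (hfa : ∀ s p, f (s, a s p) = g (s, p))
    {F : Filter T} [NeBot F] (hF : F ≤ 𝓝 t) {p q : L} {U : Set L} (hU : U ∈ 𝓝 q)
    (hinj : InjOn (fun x => f (t, x)) U) (hlim : Tendsto (fun s => a s p) F (𝓝 q)) :
    Tendsto (fun z : T × L => a z.1 z.2) (F ×ˢ 𝓝 p) (𝓝 q) := by
  have hFt : Tendsto (fun s : T => s) F (𝓝 t) := hF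
  have hq : f (t, q) = g (t, p) := by
    refine tendsto_nhds_unique (hf.continuousAt.tendsto.comp (hFt.prodMk_nhds hlim)) ?_
    refine ((hg.continuousAt (x := (t, p))).tendsto.comp
      (hFt.prodMk_nhds tendsto_const_nhds)).congr fun s => ?_
    exact (hfa s p).symm
  intro V hV
  obtain ⟨N, hN, hNc, hNV⟩ := exists_mem_nhds_isClosed_subset (inter_mem hV hU)
  have hclN : closure (interior N) ⊆ N := closure_minimal interior_subset hNc
  have hqN : q ∈ interior N := mem_interior_iff_mem_nhds.2 hN
  have hK : IsCompact (frontier (interior N)) := isClosed_frontier.isCompact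
  -- The frontier acts as a barrier: by local injectivity `f (t, ·)` misses the value `g (t, p)` on
  -- it, and by compactness this persists for all nearby `(s, x)`.
  have hne : ∀ᶠ z in 𝓝 (t, p), ∀ k ∈ frontier (interior N), f (z.1, k) ≠ g z := by
    refine hK.eventually_forall_of_forall_eventually fun k hk => ?_
    have hk' : f (t, k) ≠ g (t, p) := by
      rw [← hq]
      intro h
      have : k = q := hinj (hNV (hclN (frontier_subset_closure hk))).2 (mem_of_mem_nhds hU) h
      rw [isOpen_interior.frontier_eq, this] at hk
      exact hk.2 hqN
    have h1 : Continuous fun w : (T × L) × L => f (w.1.1, w.2) := by fun_prop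
    have h2 : Continuous fun w : (T × L) × L => g w.1 := by fun_prop
    exact (isOpen_ne_fun h1 h2).mem_nhds (x := ((t, p), k)) hk'
  rw [nhds_prod_eq] at hne
  obtain ⟨A, hA, B, hB, hAB⟩ := mem_prod_iff.1 hne
  obtain ⟨W, hWB, hWo, hpW, hW⟩ := locallyConnectedSpace_iff_subsets_isOpen_isConnected.1
    ‹LocallyConnectedSpace L› p B hB
  refine mem_prod_iff.2 ⟨A ∩ {s | a s p ∈ interior N}, inter_mem (hF hA)
    (hlim (isOpen_interior.mem_nhds hqN)), W, hWo.mem_nhds hpW, ?_⟩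
  rintro ⟨s, x⟩ ⟨⟨hsA, hs⟩, hx⟩
  -- The image of the connected set `W` starts in `interior N` at `p` and cannot cross the barrier.
  have himg : a s '' W ⊆ interior N := by
    refine (hW.isPreconnected.image _ (ha s).continuousOn).subset_left_of_subset_union
      isOpen_interior isClosed_closure.isOpen_compl
      (disjoint_compl_right.mono_left subset_closure) ?_ ⟨_, ⟨p, hpW, rfl⟩, hs⟩
    rintro _ ⟨y, hy, rfl⟩
    by_contra hcon
    rw [mem_union, not_or, notMem_compl_iff] at hcon
    refine hAB (mk_mem_prod hsA (hWB hy)) (a s y) ?_ (hfa s y)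
    rw [isOpen_interior.frontier_eq]
    exact ⟨hcon.2, hcon.1⟩
  exact (hNV (interior_subset (himg ⟨x, hx, rfl⟩))).1

/-- Along an ultrafilter, the solutions `a s` of `f (s, a s p) = g (s, p)` converge locally
uniformly to a continuous map, provided that `f (t, ·)` is locally injective. -/
theorem exists_continuous_tendsto_prod (hf : Continuous f) (hg : Continuous g)
    (ha : ∀ s, Continuous (a s)) (hfa : ∀ s p, f (s, a s p) = g (s, p))
    (hinj : ∀ q, ∃ U ∈ 𝓝 q, InjOn (fun x => f (t, x)) U)
    (𝓤 : Ultrafilter T) (h𝓤 : (𝓤 : Filter T) ≤ 𝓝 t) :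
    ∃ b : L → L, Continuous b ∧ (∀ p, f (t, b p) = g (t, p)) ∧
      ∀ p, Tendsto (fun z : T × L => a z.1 z.2) ((𝓤 : Filter T) ×ˢ 𝓝 p) (𝓝 (b p)) := by
  -- On the compact space `L` every ultrafilter converges, so pointwise limits exist with no choice
  -- of subsequences.
  have hlim : ∀ p, ∃ q, Tendsto (fun s => a s p) 𝓤 (𝓝 q) := fun p =>
    ⟨(𝓤.map fun s => a s p).lim, (𝓤.map fun s => a s p).le_nhds_lim⟩
  choose b hb using hlim
  have hprod : ∀ p, Tendsto (fun z : T × L => a z.1 z.2) ((𝓤 : Filter T) ×ˢ 𝓝 p) (𝓝 (b p)) := by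
    intro p
    obtain ⟨U, hU, hUinj⟩ := hinj (b p)
    exact tendsto_prod_of_tendsto_apply hf hg ha hfa h𝓤 hU hUinj (hb p)
  have h𝓤t : Tendsto (fun s : T => s) 𝓤 (𝓝 t) := h𝓤
  refine ⟨b, continuous_iff_continuousAt.2 fun p => ?_, fun p => ?_, hprod⟩
  · intro V hV
    obtain ⟨N, hN, hNc, hNV⟩ := exists_mem_nhds_isClosed_subset hV
    obtain ⟨A, hA, B, hB, hAB⟩ := mem_prod_iff.1 (hprod p hN)
    refine mem_map.2 (mem_of_superset hB fun x hx => hNV ?_)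
    exact hNc.mem_of_tendsto (hb x) (mem_of_superset hA fun s hs => hAB (mk_mem_prod hs hx))
  · refine tendsto_nhds_unique (hf.continuousAt.tendsto.comp (h𝓤t.prodMk_nhds (hb p))) ?_
    refine ((hg.continuousAt (x := (t, p))).tendsto.comp
      (h𝓤t.prodMk_nhds tendsto_const_nhds)).congr fun s => ?_
    exact (hfa s p).symm

end LocallyInjective

theorem isClosed_connectedComponentIn {α : Type*} [TopologicalSpace α] {F : Set α}
    (hF : IsClosed F) (x : α) : IsClosed (connectedComponentIn F x) := by
  by_cases hx : x ∈ F
  · rw [connectedComponentIn_eq_image hx]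
    exact hF.isClosedEmbedding_subtypeVal.isClosedMap _ isClosed_connectedComponent
  · rw [connectedComponentIn_eq_empty hx]
    exact isClosed_empty

/-! ### Smooth dependence of the reparametrizations on time. -/

section Reparametrization

variable {n : ℕ} [NeZero n]
  {X : Type*} [TopologicalSpace X] [ChartedSpace (EuclideanSpace ℝ (Fin (2 * n))) X]
  [IsManifold (𝓡 (2 * n)) ∞ X]
  {L : Type*} [TopologicalSpace L]
  [ChartedSpace (EuclideanHalfSpace n) L] [IsManifold (𝓡∂ n) ∞ L]

/-- A continuous map which becomes smooth after composition with an immersion is smooth. -/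
theorem contMDiff_of_comp_immersion_slice {f g : L → X} (hf : ContMDiff (𝓡∂ n) (𝓡 (2 * n)) ∞ f)
    (himm : ∀ p, Function.Injective (mfderiv (𝓡∂ n) (𝓡 (2 * n)) f p))
    (hg : ContMDiff (𝓡∂ n) (𝓡 (2 * n)) ∞ g) {a : L → L} (ha : Continuous a)
    (hfg : ∀ p, f (a p) = g p) : ContMDiff (𝓡∂ n) (𝓡∂ n) ∞ a :=
  (contMDiff_of_comp_immersion (f := fun z : unitInterval × L => f z.2)
    (g := fun z : unitInterval × L => g z.2) (a := fun z => a z.2)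
    (hf.comp contMDiff_snd) (fun _ => himm) (hg.comp contMDiff_snd) (ha.comp continuous_snd)
    (fun _ => hfg)).comp ((contMDiff_const (c := (0 : unitInterval))).prodMk contMDiff_id)

variable [T2Space X] [T2Space L] [CompactSpace L]

/-- The reparametrizations which relate two smooth families of free immersions form a smooth
family. -/
theorem contMDiff_reparametrization {f g : unitInterval × L → X}
    (hf : ContMDiff ((𝓡∂ 1).prod (𝓡∂ n)) (𝓡 (2 * n)) ∞ f)
    (himm : ∀ t p, Function.Injective (mfderiv (𝓡∂ n) (𝓡 (2 * n)) (fun q => f (t, q)) p))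
    (hfree : ∀ t, ∀ ψ : L ≃ₘ^∞⟮𝓡∂ n, 𝓡∂ n⟯ L, PreservesBoundaryComponents ψ →
      (∀ p, f (t, ψ p) = f (t, p)) → ∀ p, ψ p = p)
    (hg : ContMDiff ((𝓡∂ 1).prod (𝓡∂ n)) (𝓡 (2 * n)) ∞ g)
    (hgimm : ∀ t p, Function.Injective (mfderiv (𝓡∂ n) (𝓡 (2 * n)) (fun q => g (t, q)) p))
    {α : unitInterval → L ≃ₘ^∞⟮𝓡∂ n, 𝓡∂ n⟯ L} (hα : ∀ t, PreservesBoundaryComponents (α t))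
    (hfg : ∀ t p, f (t, α t p) = g (t, p)) :
    ContMDiff ((𝓡∂ 1).prod (𝓡∂ n)) (𝓡∂ n) ∞ fun z : unitInterval × L => α z.1 z.2 := by
  have : LocallyConnectedSpace L := ChartedSpace.locallyConnectedSpace (EuclideanHalfSpace n) L
  refine contMDiff_of_comp_immersion hf himm hg (continuous_iff_continuousAt.2 ?_) hfg
  rintro ⟨t, p⟩
  have key : ∀ 𝓤 : Ultrafilter unitInterval, (𝓤 : Filter unitInterval) ≤ 𝓝 t →
      Tendsto (fun z : unitInterval × L => α z.1 z.2) ((𝓤 : Filter unitInterval) ×ˢ 𝓝 p)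
        (𝓝 (α t p)) := by
    intro 𝓤 h𝓤
    obtain ⟨a, hac, hfa, ha⟩ := exists_continuous_tendsto_prod (a := fun s p => α s p) hf.continuous
      hg.continuous (fun s => (α s).contMDiff.continuous) hfg (exists_nhds_injOn hf himm t) 𝓤 h𝓤
    -- The inverses solve the equation with `f` and `g` exchanged, so they converge as well. Locally
    -- uniform convergence makes the two limits inverse to each other.
    obtain ⟨b, hbc, hgb, hb⟩ := exists_continuous_tendsto_prod (a := fun s p => (α s).symm p)
      hg.continuous hf.continuous (fun s => (α s).symm.contMDiff.continuous)
      (fun s q => by rw [← hfg, Diffeomorph.apply_symm_apply])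
      (exists_nhds_injOn hg hgimm t) 𝓤 h𝓤
    have hpt : ∀ q : L, Tendsto (fun s : unitInterval => (s, q)) (𝓤 : Filter unitInterval)
        ((𝓤 : Filter unitInterval) ×ˢ 𝓝 q) := fun q => tendsto_id.prodMk tendsto_const_nhds
    have hab : ∀ q, a (b q) = q := by
      intro q
      refine tendsto_nhds_unique
        ((ha (b q)).comp (tendsto_id.prodMk ((hb q).comp (hpt q)))) ?_
      refine tendsto_const_nhds.congr fun s => ?_
      simp
    have hba : ∀ q, b (a q) = q := by
      intro q
      refine tendsto_nhds_unique
        ((hb (a q)).comp (tendsto_id.prodMk ((ha q).comp (hpt q)))) ?_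
      refine tendsto_const_nhds.congr fun s => ?_
      simp
    let χ : L ≃ₘ^∞⟮𝓡∂ n, 𝓡∂ n⟯ L :=
      { toFun := a
        invFun := b
        left_inv := hba
        right_inv := hab
        contMDiff_toFun := contMDiff_of_comp_immersion_slice (contMDiff_slice_right hf t) (himm t)
          (contMDiff_slice_right hg t) hac hfa
        contMDiff_invFun := contMDiff_of_comp_immersion_slice (contMDiff_slice_right hg t)
          (hgimm t) (contMDiff_slice_right hf t) hbc hgb }
    -- Boundary components are closed, so preserving them passes to the limit.
    have hχ : PreservesBoundaryComponents χ := by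
      intro x hx y hy
      exact (isClosed_connectedComponentIn ((𝓡∂ n).isClosed_boundary (n := ∞) (by simp)) x).mem_of_tendsto
        ((ha y).comp (hpt y)) (Eventually.of_forall fun s => hα s x hx hy)
    -- Both `χ` and `α t` carry `f_t` to `g_t`, so `χ ∘ (α t)⁻¹` fixes `f_t` and is the identity by
    -- freeness.
    have h := hfree t ((α t).symm.trans χ) (fun x hx => (hχ x hx).comp ((hα t).symm x hx))
      (fun q => by
        change f (t, a ((α t).symm q)) = f (t, q)
        rw [hfa, ← hfg, Diffeomorph.apply_symm_apply]) (α t p)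
    have h' : a p = α t p := by
      change a ((α t).symm (α t p)) = α t p at h
      rwa [Diffeomorph.symm_apply_apply] at h
    rw [← h']
    exact ha p
  -- Continuity at `(t, p)` is tested on ultrafilters `𝓥` of the product; only the time component
  -- needs to be an ultrafilter, since convergence is locally uniform in the point.
  refine tendsto_iff_ultrafilter _ _ _ |>.2 fun 𝓥 h𝓥 => ?_
  rw [nhds_prod_eq] at h𝓥
  have h1 : ((𝓥.map Prod.fst : Ultrafilter unitInterval) : Filter unitInterval) ≤ 𝓝 t :=
    (map_mono h𝓥).trans tendsto_fst
  refine (key _ h1).mono_left (le_prod.2 ⟨le_rfl, (map_mono h𝓥).trans tendsto_snd⟩)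

end Reparametrization

theorem PreservesBoundaryComponents.apply_mem {n : ℕ} [NeZero n]
    {L : Type*} [TopologicalSpace L] [ChartedSpace (EuclideanHalfSpace n) L] {d : ℕ}
    {C : Fin d → Set L} (hC : IsBoundaryEnumeration n C)
    {ψ : L ≃ₘ^∞⟮𝓡∂ n, 𝓡∂ n⟯ L} (hψ : PreservesBoundaryComponents ψ) {i : Fin d} {p : L}
    (hp : p ∈ C i) : ψ p ∈ C i := by
  have hi : C i ∈ range C := mem_range_self i
  rw [hC.2] at hi
  obtain ⟨x, hx, hCx⟩ := hi
  rw [hCx] at hp ⊢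
  exact hψ x hx hp

/-! ### Properties of smooth liftings. -/

section Lifts

variable {n : ℕ} [NeZero n]
  {X : Type*} [TopologicalSpace X] [ChartedSpace (EuclideanSpace ℝ (Fin (2 * n))) X]
  {L : Type*} [TopologicalSpace L] [ChartedSpace (EuclideanHalfSpace n) L]
  [IsManifold (𝓡∂ n) ∞ L]
  {F : Type*} [NormedAddCommGroup F] [NormedSpace ℝ F] {G : Type*} [TopologicalSpace G]
  {Y : Type*} [TopologicalSpace Y] [ChartedSpace G Y] {J : ModelWithCorners ℝ F G}
  {d : ℕ} {ωX : DForm (𝓡 (2 * n)) X 2} {C : Fin d → Set L} {Λ : Fin d → Set X}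
  {Z : Y → Moduli ωX C Λ} {f : Y × L → X}

theorem IsSmoothLift.injective_mfderiv (hf : IsSmoothLift J Z f) (y : Y) (p : L) :
    Function.Injective (mfderiv (𝓡∂ n) (𝓡 (2 * n)) (fun q => f (y, q)) p) := by
  obtain ⟨g, hg, -⟩ := hf.2 y
  exact hg ▸ g.immersion p

theorem IsSmoothLift.free (hf : IsSmoothLift J Z f) (y : Y) (ψ : L ≃ₘ^∞⟮𝓡∂ n, 𝓡∂ n⟯ L)
    (hψ : PreservesBoundaryComponents ψ) (h : ∀ p, f (y, ψ p) = f (y, p)) (p : L) : ψ p = p := by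
  obtain ⟨g, hg, -⟩ := hf.2 y
  exact g.free ψ hψ (by rw [hg]; exact funext h) p

theorem IsSmoothLift.lagrangian (hf : IsSmoothLift J Z f) (y : Y) (p : L) :
    (ωX (f (y, p))).compContinuousLinearMap
      (mfderiv (𝓡∂ n) (𝓡 (2 * n)) (fun q => f (y, q)) p) = 0 := by
  obtain ⟨g, hg, -⟩ := hf.2 y
  have h := g.lagrangian p
  rw [hg] at h
  exact h

theorem IsSmoothLift.boundary_mem (hf : IsSmoothLift J Z f) (y : Y) (i : Fin d) (p : L)
    (hp : p ∈ C i) : f (y, p) ∈ Λ i := by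
  obtain ⟨g, hg, -⟩ := hf.2 y
  have h := g.boundary_mem i p hp
  rw [hg] at h
  exact h

theorem IsSmoothLift.comp_param {F' : Type*} [NormedAddCommGroup F'] [NormedSpace ℝ F']
    {G' : Type*} [TopologicalSpace G'] {Y' : Type*} [TopologicalSpace Y'] [ChartedSpace G' Y']
    {J' : ModelWithCorners ℝ F' G'} (hf : IsSmoothLift J Z f) {φ : Y' → Y}
    (hφ : ContMDiff J' J ∞ φ) :
    IsSmoothLift J' (fun y => Z (φ y)) (fun z : Y' × L => f (φ z.1, z.2)) :=
  ⟨hf.1.comp ((hφ.comp contMDiff_fst).prodMk contMDiff_snd), fun y => hf.2 (φ y)⟩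

theorem IsSmoothLift.fluxForm_mem_relClosed {Z : unitInterval → Moduli ωX C Λ}
    {f : unitInterval × L → X} [IsManifold (𝓡 (2 * n)) ∞ X] (hω : IsSymplectic ωX)
    (hC : IsBoundaryEnumeration n C) (hΛ : ∀ i, IsLagrangianSubmanifold ωX (Λ i))
    (hf : IsSmoothLift (𝓡∂ 1) Z f) : fluxForm ωX f ∈ relClosed n L 1 :=
  ⟨⟨isSmoothForm_fluxForm hω.smooth hf.1,
    vanishesOnBoundary_fluxForm hω.smooth hC hΛ hf.1 hf.boundary_mem⟩,
    extD_fluxForm hω.smooth hω.closed hf.1 hf.lagrangian⟩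

end Lifts

/-! ### Invariance of the flux under reparametrization and homotopy. -/

section Invariance

variable {n : ℕ} [NeZero n]
  {X : Type*} [TopologicalSpace X] [ChartedSpace (EuclideanSpace ℝ (Fin (2 * n))) X]
  [IsManifold (𝓡 (2 * n)) ∞ X]
  {L : Type*} [TopologicalSpace L]
  [ChartedSpace (EuclideanHalfSpace n) L] [IsManifold (𝓡∂ n) ∞ L]
  {d : ℕ} {ωX : DForm (𝓡 (2 * n)) X 2} {C : Fin d → Set L} {Λ : Fin d → Set X}

/-- Two smooth liftings of a path differ by a smooth path of reparametrizations. -/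
theorem IsSmoothLift.exists_reparametrization [T2Space X] [T2Space L] [CompactSpace L]
    {Z Z' : unitInterval → Moduli ωX C Λ} {f g : unitInterval × L → X} (hf : IsSmoothLift (𝓡∂ 1) Z f) (hg : IsSmoothLift (𝓡∂ 1) Z' g)
    (hZ : ∀ t, Z t = Z' t) :
    ∃ α : unitInterval → L ≃ₘ^∞⟮𝓡∂ n, 𝓡∂ n⟯ L, (∀ t, PreservesBoundaryComponents (α t)) ∧
      (∀ t p, f (t, α t p) = g (t, p)) ∧
      ContMDiff ((𝓡∂ 1).prod (𝓡∂ n)) (𝓡∂ n) ∞ fun z : unitInterval × L => α z.1 z.2 := by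
  have h : ∀ t, ∃ ψ : L ≃ₘ^∞⟮𝓡∂ n, 𝓡∂ n⟯ L, PreservesBoundaryComponents ψ ∧
      ∀ p, f (t, ψ p) = g (t, p) := by
    intro t
    obtain ⟨φ, hφ, hφZ⟩ := hf.2 t
    obtain ⟨γ, hγ, hγZ⟩ := hg.2 t
    obtain ⟨ψ, hψ, h⟩ := Quotient.exact (hφZ.symm.trans ((hZ t).trans hγZ))
    rw [hφ, hγ] at h
    exact ⟨ψ, hψ, fun p => (congrFun h p).symm⟩
  choose α hα hfg using h
  exact ⟨α, hα, hfg, contMDiff_reparametrization hf.1 hf.injective_mfderiv hf.free hg.1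
    hg.injective_mfderiv hα hfg⟩

theorem contMDiff_unitInterval_mul : ContMDiff ((𝓡∂ 1).prod (𝓡∂ 1)) (𝓡∂ 1) ∞
    fun y : unitInterval × unitInterval => y.1 * y.2 := by
  rw [contMDiff_iff_comp_subtypeVal_Icc]
  have h : ContMDiff (𝓡∂ 1) 𝓘(ℝ, ℝ) ∞ fun t : unitInterval => (t : ℝ) := contMDiff_subtypeVal_Icc
  exact ⟨continuous_mul, (contDiff_mul (𝕜 := ℝ) (𝔸 := ℝ)).contMDiff.comp
    ((h.comp contMDiff_fst).prodMk_space (h.comp contMDiff_snd))⟩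

/-- Reparametrizing a path of Lagrangian immersions by a path of diffeomorphisms which starts at the
identity changes the flux form by an exact form. -/
theorem fluxForm_sub_reparametrization_mem_relExact (hω : IsSymplectic ωX)
    (hC : IsBoundaryEnumeration n C) (hΛ : ∀ i, IsLagrangianSubmanifold ωX (Λ i))
    {Z : unitInterval → Moduli ωX C Λ} {f : unitInterval × L → X}
    (hf : IsSmoothLift (𝓡∂ 1) Z f) {β : unitInterval → L ≃ₘ^∞⟮𝓡∂ n, 𝓡∂ n⟯ L}
    (hβ : ∀ t, PreservesBoundaryComponents (β t)) (hβ₀ : ∀ p, β 0 p = p)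
    (hβs : ContMDiff ((𝓡∂ 1).prod (𝓡∂ n)) (𝓡∂ n) ∞ fun z : unitInterval × L => β z.1 z.2) :
    fluxForm ωX f - fluxForm ωX (fun q : unitInterval × L => f (q.1, β q.1 q.2)) ∈
      relExact n L 0 := by
  -- The homotopy `f (t, β (u * t) p)` joins `f` (as `β 0 = id`) to the reparametrized path; at a
  -- fixed time it only reparametrizes `f_t`.
  have h := fluxForm_sub_mem_relExact hω.smooth hω.closed hC hΛ
    (h := fun z : (unitInterval × unitInterval) × L => f (z.1.2, β (z.1.1 * z.1.2) z.2))
    (hf.1.comp ((contMDiff_snd.comp contMDiff_fst).prodMk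
      (hβs.comp ((contMDiff_unitInterval_mul.comp contMDiff_fst).prodMk contMDiff_snd))))
    (fun y i p hp => hf.boundary_mem _ i _ ((hβ _).apply_mem hC hp)) ?_
  · simpa only [zero_mul, one_mul, hβ₀] using h
  · intro t ht
    refine ⟨fun p => f (t, p), fun z => β (z.1 * t) z.2, contMDiff_slice_right hf.1 t,
      hf.lagrangian t, ?_, fun u p => rfl⟩
    exact hβs.comp ((contMDiff_unitInterval_mul.comp (contMDiff_fst.prodMk
      contMDiff_const)).prodMk contMDiff_snd)

/-- Liftings with the same initial immersion of homotopic paths have flux forms which differ by an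
exact form. -/
theorem IsSmoothLift.fluxForm_sub_mem_relExact [T2Space X] [T2Space L] [CompactSpace L]
    (hω : IsSymplectic ωX)
    (hC : IsBoundaryEnumeration n C) (hΛ : ∀ i, IsLagrangianSubmanifold ωX (Λ i))
    {Z Z' : unitInterval → Moduli ωX C Λ} {f f' : unitInterval × L → X}
    (hf : IsSmoothLift (𝓡∂ 1) Z f) (hf' : IsSmoothLift (𝓡∂ 1) Z' f')
    (h₀ : ∀ p, f (0, p) = f' (0, p)) (hZ : SmoothlyHomotopic Z Z') :
    fluxForm ωX f - fluxForm ωX f' ∈ relExact n L 0 := by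
  obtain ⟨H, ⟨h, hh⟩, hHZ, hHZ', hH₀, hH₁⟩ := hZ
  have hl : ∀ u : unitInterval, ContMDiff (𝓡∂ 1) ((𝓡∂ 1).prod (𝓡∂ 1)) ∞
      fun t : unitInterval => (u, t) := fun u => contMDiff_const.prodMk contMDiff_id
  have hr : ∀ t : unitInterval, ContMDiff (𝓡∂ 1) ((𝓡∂ 1).prod (𝓡∂ 1)) ∞
      fun u : unitInterval => (u, t) := fun t => contMDiff_id.prodMk contMDiff_const
  have hconst : ∀ t : unitInterval, ContMDiff (𝓡∂ 1) (𝓡∂ 1) ∞ fun _ : unitInterval => t :=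
    fun t => contMDiff_const
  -- Along the edge `t = 0` the lift satisfies `h ((u, 0), θ u p) = f (0, p)`; along `t = 1` it
  -- satisfies `h ((u, 1), p) = f (1, ψ u p)`. Both `θ` and `ψ` are smooth in `u`.
  obtain ⟨θ, hθ, hhθ, hθs⟩ := (hh.comp_param (hr 0)).exists_reparametrization
    (hf.comp_param (hconst 0)) fun u => (hH₀ u).1
  obtain ⟨ψ, -, hfψ, hψs⟩ := (hf.comp_param (hconst 1)).exists_reparametrization
    (hh.comp_param (hr 1)) fun u => (hH₁ u).1.symm
  have hθs' : ∀ u : unitInterval, ContMDiff ((𝓡∂ 1).prod (𝓡∂ n)) ((𝓡∂ 1).prod (𝓡∂ n)) ∞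
      fun z : unitInterval × L => (z.1, θ u z.2) := fun u =>
    contMDiff_fst.prodMk ((θ u).contMDiff.comp contMDiff_snd)
  -- Reparametrizing by `θ u` makes every path of the homotopy start at `f_0`; the other end moves
  -- by reparametrizations of `f_1`.
  have key := LagFlux.fluxForm_sub_mem_relExact hω.smooth hω.closed hC hΛ
    (h := fun z : (unitInterval × unitInterval) × L => h (z.1, θ z.1.1 z.2))
    (hh.1.comp (contMDiff_fst.prodMk (hθs.comp
      ((contMDiff_fst.comp contMDiff_fst).prodMk contMDiff_snd))))
    (fun y i p hp => hh.boundary_mem _ i _ ((hθ _).apply_mem hC hp)) (by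
      rintro t (rfl | rfl)
      · exact ⟨fun p => f (0, p), Prod.snd, contMDiff_slice_right hf.1 0, hf.lagrangian 0,
          contMDiff_snd, hhθ⟩
      · exact ⟨fun p => f (1, p), fun z => ψ z.1 (θ z.1 z.2), contMDiff_slice_right hf.1 1,
          hf.lagrangian 1, hψs.comp (contMDiff_fst.prodMk hθs), fun u p => (hfψ u _).symm⟩)
  -- On each side `u = 0, 1`, the given lifting and the corrected `h` lift the same path and start
  -- at the same immersion.
  have hside : ∀ (u : unitInterval) {Z : unitInterval → Moduli ωX C Λ} {f : unitInterval × L → X},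
      IsSmoothLift (𝓡∂ 1) Z f → (∀ t, H (u, t) = Z t) → (∀ p, h ((u, 0), θ u p) = f (0, p)) →
      fluxForm ωX f - fluxForm ωX (fun q : unitInterval × L => h ((u, q.1), θ u q.2)) ∈
        relExact n L 0 := by
    intro u Z f hf hHZ hfh
    obtain ⟨α, hα, hfα, hαs⟩ := hf.exists_reparametrization (hh.comp_param (hl u))
      fun t => (hHZ t).symm
    have hβ : ∀ t, PreservesBoundaryComponents ((θ u).trans (α t)) := fun t x hx =>
      (hα t x hx).comp (hθ u x hx)
    have := fluxForm_sub_reparametrization_mem_relExact hω hC hΛ hf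
      (β := fun t => (θ u).trans (α t)) hβ
      -- The connecting diffeomorphism at time `0` fixes `f_0`, so freeness makes it the identity.
      (hf.free 0 _ (hβ 0) fun p => (hfα 0 (θ u p)).trans (hfh p)) (hαs.comp (hθs' u))
    convert this using 4 with q
    exact (hfα q.1 (θ u q.2)).symm
  have h1 := hside 0 hf hHZ (hhθ 0)
  have h2 := hside 1 hf' hHZ' fun p => (hhθ 1 p).trans (h₀ p)
  -- Telescoping through the flux forms of the two sides of the corrected homotopy.
  have := sub_mem (add_mem h1 key) h2
  convert this using 1
  abel

end Invariance

end LagFlux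

end

/-! ### Well-definedness and homotopy invariance of the relative Lagrangian flux. -/

theorem mainTheorem3 {n : ℕ} [NeZero n]
    {X : Type*} [TopologicalSpace X] [T2Space X] [SecondCountableTopology X]
    [ChartedSpace (EuclideanSpace ℝ (Fin (2 * n))) X] [IsManifold (𝓡 (2 * n)) ∞ X]
    {L : Type*} [TopologicalSpace L] [T2Space L] [CompactSpace L]
    [ChartedSpace (EuclideanHalfSpace n) L] [IsManifold (𝓡∂ n) ∞ L]
    (ωX : LagFlux.DForm (𝓡 (2 * n)) X 2) (hω : LagFlux.IsSymplectic ωX)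
    {d : ℕ} (C : Fin d → Set L) (hC : LagFlux.IsBoundaryEnumeration n C)
    (Λ : Fin d → Set X) (hΛ : ∀ i, LagFlux.IsLagrangianSubmanifold ωX (Λ i))
    (hdisj : Pairwise fun i j => Disjoint (Λ i) (Λ j)) :
    ∃ hwd : ∀ (Z : unitInterval → LagFlux.Moduli ωX C Λ) (f : unitInterval × L → X),
        LagFlux.IsSmoothLift (𝓡∂ 1) Z f →
          (∀ p, MeasureTheory.Integrable (LagFlux.fluxIntegrand ωX f p)) ∧
          LagFlux.fluxForm ωX f ∈ LagFlux.relClosed n L 1,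
      ∀ (Z Z' : unitInterval → LagFlux.Moduli ωX C Λ) (f f' : unitInterval × L → X)
        (hf : LagFlux.IsSmoothLift (𝓡∂ 1) Z f) (hf' : LagFlux.IsSmoothLift (𝓡∂ 1) Z' f'),
        (∀ p, f (0, p) = f' (0, p)) → LagFlux.SmoothlyHomotopic Z Z' →
          LagFlux.relFlux ωX f (hwd Z f hf).2 = LagFlux.relFlux ωX f' (hwd Z' f' hf').2 := by
  refine ⟨fun Z f hf => ⟨fun p => LagFlux.integrable_fluxIntegrand hω.smooth hf.1 p,
    hf.fluxForm_mem_relClosed hω hC hΛ⟩, fun Z Z' f f' hf hf' h₀ hZ => ?_⟩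
  exact (Submodule.Quotient.eq _).2 (hf.fluxForm_sub_mem_relExact hω hC hΛ hf' h₀ hZ)
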